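/- Let $\alpha\in\mathbb{R}$ with $|\alpha|>1$ be fixed, and let $f\colon\mathbb{R}\to\mathbb{C}$ be a $1$-periodic function in $L^1_{\mathrm{loc}}(\mathbb{R})$. Assume that there is a finite set $F\subset[0,1]$ such that, for every $\delta>0$, $f$ is Riemann-integrable on $[0,1]\setminus\bigl(F+(-\delta,\delta)\bigr)$. Assume further that, for every $z\in F$, there is a $\delta_z>0$ such that $f$ is differentiable on $(z-\delta_z,z+\delta_z)\setminus\{z\}$ and such that, for every $s>0$, there is an $\eta=\eta(z,s)>0$ with $$V_N(z,s):=\int_{z-\delta_z}^{z-N^{-s}}|f'(x)|\,\mathrm{d}x+\int_{z+N^{-s}}^{z+\delta_z}|f'(x)|\,\mathrm{d}x \,=\, o\bigl(N^{\frac{s}{2}-\eta}\bigr)\qquad\text{as } N\to\infty,$$ where, for all large $N$, this includes the integrability of $|f'|$ over the intervals involved. Then, for Lebesgue-almost every $x\in\mathbb{R}$, $$\frac1N\sum_{n=0}^{N-1}f(\alpha^n x)\;\xrightarrow{\,N\to\infty\,}\;\int_0^1 f(y)\,\mathrm{d}y ,$$ and this limit equals the mean $M(f)=\lim_{T\to\infty}\frac{1}{2T}\int_{-T}^{T}f(y)\,\mathrm{d}y$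 of $f$ (in particular, the latter limit exists). -/

import Mathlib

open Set Filter Topology MeasureTheory
open scoped Pointwise ENNReal

namespace SobolAverage

/-- The interval from `a` to `b`, as a one-dimensional box. -/
def intervalBox (a b : ℝ) (h : a < b) : BoxIntegral.Box (Fin 1) :=
  ⟨fun _ => a, fun _ => b, fun _ => h⟩

/-- `f` is Riemann-integrable on the compact interval `[a, b]`: its Riemann sums over tagged
partitions converge as the mesh tends to `0` (no condition if `b ≤ a`). -/
def RiemannIntegrableIcc (f : ℝ → ℂ) (a b : ℝ) : Prop :=
  ∀ h : a < b,
    BoxIntegral.Integrable (intervalBox a b h) BoxIntegral.IntegrationParams.Riemann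
      (fun x : Fin 1 → ℝ => f (x 0))
      ((volume : Measure (Fin 1 → ℝ)).toBoxAdditive.toSMul (E := ℂ))

/-- `f` is Riemann-integrable on the subset `A` of `[a, b]`: the extension of `f|_A` by zero is
Riemann-integrable on `[a, b]`. Here, `A` will be a finite union of compact intervals. -/
def RiemannIntegrableOn (f : ℝ → ℂ) (A : Set ℝ) (a b : ℝ) : Prop :=
  RiemannIntegrableIcc (A.indicator f) a b

/-- The variation `V_N(z,s)`, the integral of `|f'|` over
`(z - δ, z - N⁻ˢ) ∪ (z + N⁻ˢ, z + δ)`, with value `∞` if `|f'|` is not integrable there. -/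
noncomputable def V (f : ℝ → ℂ) (z δ s : ℝ) (N : ℕ) : ℝ≥0∞ :=
  (∫⁻ x in Ioo (z - δ) (z - 1 / (N : ℝ) ^ s), ‖deriv f x‖ₑ) +
    ∫⁻ x in Ioo (z + 1 / (N : ℝ) ^ s) (z + δ), ‖deriv f x‖ₑ

/-- The mean `M(f) = lim_{T → ∞} (2T)⁻¹ ∫_{-T}^{T} f(y) dy` exists and equals `m`. -/
def HasMean (f : ℝ → ℂ) (m : ℂ) : Prop :=
  Tendsto (fun T : ℝ => (1 / (2 * T : ℂ)) * ∫ y in (-T)..T, f y) atTop (𝓝 m)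

end SobolAverage

/-!
For a lacunary sequence `a`, the centred indicators of arcs composed with `x ↦ a n * x` have
exponentially decaying correlations on bounded intervals: one factor is constant on long intervals
on which the other one completes many periods. Hence the sum of the first `N` of them has second
moment at most a constant times `ℓ * N` for arcs of length `ℓ`, and summing over the squares
`N = j ^ 2` gives, for almost every `x`, both the equidistribution of `a n * x` modulo `1` and
bounds `C * (ℓ i + 1 / c i) * N` for the visits to countably many arcs at once, provided that
`∑ i, c i ^ 2 * ℓ i < ∞`. With arcs around `z` of length comparable to `2 ^ (-k)` and `c` growing
more slowly than `2 ^ (k / 2)`, this bounds `∑ n < N, ‖a n * x - z‖ ^ (-γ)` by a multiple of `N` for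
every `γ < 1 / 2`.

The variation hypothesis at the single exponent `s = 1` yields `f y = O(|y - z| ^ (-β))` for some
`β < 1 / 2`, so the terms near `F` contribute arbitrarily little to the averages. Away from `F`, the
function is Riemann-integrable and Weyl's argument applies: the average over one cell of a uniform
partition lies in the convex hull of the values on that cell, so it is controlled by Riemann sums.
-/

namespace SobolAverage

/-! ### Periodic functions and arcs -/

section Periodic

variable {E : Type*} [NormedAddCommGroup E] [NormedSpace ℝ E] {f : ℝ → E} {T : ℝ}

theorem norm_intervalIntegral_le_of_periodic (hf : Function.Periodic f T) (hT : 0 < T)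
    (hfi : IntervalIntegrable f volume 0 T) (hf0 : ∫ y in (0 : ℝ)..T, f y = 0) (p q : ℝ) :
    ‖∫ y in p..q, f y‖ ≤ ∫ y in (0 : ℝ)..T, ‖f y‖ := by
  have hint : ∀ s t, IntervalIntegrable f volume s t := hf.intervalIntegrable₀ hT.ne' hfi
  obtain ⟨n, ⟨hpr, hrp⟩, -⟩ := existsUnique_sub_zsmul_mem_Ico hT q p
  set r := q - n • T with hr
  have hperiods : ∫ y in r..q, f y = 0 := by
    have hq : q = r + n • T := by rw [hr, sub_add_cancel]
    rw [hq, hf.intervalIntegral_add_zsmul_eq n r hint,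
      hf.intervalIntegral_add_eq r 0, zero_add, hf0, smul_zero]
  calc ‖∫ y in p..q, f y‖ = ‖∫ y in p..r, f y‖ := by
        rw [← intervalIntegral.integral_add_adjacent_intervals (hint p r) (hint r q), hperiods,
          add_zero]
    _ ≤ ∫ y in p..r, ‖f y‖ := intervalIntegral.norm_integral_le_integral_norm hpr
    _ ≤ ∫ y in p..p + T, ‖f y‖ :=
        intervalIntegral.integral_mono_interval le_rfl hpr hrp.le
          (ae_of_all _ fun y => norm_nonneg (f y)) (hint p (p + T)).norm
    _ = ∫ y in (0 : ℝ)..T, ‖f y‖ := by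
        simpa only [zero_add, Function.comp_apply] using
          (hf.comp norm).intervalIntegral_add_eq p 0

theorem norm_intervalIntegral_comp_mul_le_of_periodic (hf : Function.Periodic f T) (hT : 0 < T)
    (hfi : IntervalIntegrable f volume 0 T) (hf0 : ∫ y in (0 : ℝ)..T, f y = 0) {c : ℝ}
    (hc : c ≠ 0) (p q : ℝ) :
    ‖∫ y in p..q, f (c * y)‖ ≤ |c|⁻¹ * ∫ y in (0 : ℝ)..T, ‖f y‖ := by
  rw [intervalIntegral.integral_comp_mul_left f hc, norm_smul, Real.norm_eq_abs, abs_inv]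
  exact mul_le_mul_of_nonneg_left (norm_intervalIntegral_le_of_periodic hf hT hfi hf0 _ _)
    (by positivity)

end Periodic

theorem hasMean_of_periodic {f : ℝ → ℂ} (hf : Function.Periodic f 1)
    (hfi : IntervalIntegrable f volume 0 1) : HasMean f (∫ y in (0 : ℝ)..1, f y) := by
  set I := ∫ y in (0 : ℝ)..1, f y with hI
  have hfi' : IntervalIntegrable (fun y => f y - I) volume 0 1 := hfi.sub intervalIntegrable_const
  have hmean : ∀ T : ℝ, T ≠ 0 → (1 / (2 * T : ℂ)) * ∫ y in (-T)..T, f y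
      = I + (2 * T)⁻¹ • ∫ y in (-T)..T, (f y - I) := fun T hT => by
    have hT' : (T : ℂ) ≠ 0 := by exact_mod_cast hT
    rw [intervalIntegral.integral_sub (hf.intervalIntegrable₀ one_ne_zero hfi _ _)
      intervalIntegrable_const, intervalIntegral.integral_const]
    simp only [Complex.real_smul]
    push_cast
    field_simp
    ring
  have hbdd : ∀ T : ℝ, ‖∫ y in (-T)..T, (f y - I)‖ ≤ ∫ y in (0 : ℝ)..1, ‖f y - I‖ := fun T =>
    norm_intervalIntegral_le_of_periodic (f := fun y => f y - I) (fun y => by simp only [hf y])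
      one_pos hfi' (by simp [intervalIntegral.integral_sub hfi, hI]) _ _
  have hinv : Tendsto (fun T : ℝ => (2 * T)⁻¹) atTop (𝓝 0) :=
    tendsto_inv_atTop_zero.comp (tendsto_id.const_mul_atTop two_pos)
  have hlim := (hinv.zero_smul_isBoundedUnder_le
    (isBoundedUnder_of ⟨_, hbdd⟩)).const_add I
  rw [add_zero] at hlim
  refine hlim.congr' ?_
  filter_upwards [eventually_ne_atTop 0] with T hT using (hmean T hT).symm

theorem norm_intervalIntegral_le_of_cells {E : Type*} [NormedAddCommGroup E] [NormedSpace ℝ E]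
    {h : ℝ → E} {κ u : ℝ} (hint : ∀ p q, IntervalIntegrable h volume p q)
    (hcell : ∀ (k : ℤ) (p q : ℝ), u + k ≤ p → p ≤ q → q ≤ u + k + 1 → ‖∫ y in p..q, h y‖ ≤ κ)
    (p q : ℝ) :
    ‖∫ y in p..q, h y‖ ≤ κ * (|q - p| + 2) := by
  wlog hpq : p ≤ q generalizing p q
  · rw [intervalIntegral.integral_symm, norm_neg, abs_sub_comm]
    exact this q p (le_of_not_ge hpq)
  have hκ : 0 ≤ κ :=
    (norm_nonneg _).trans (hcell 0 u u (by simp) le_rfl (by simp))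
  set k := ⌊p - u⌋
  have hkp : u + k ≤ p := by linarith [Int.floor_le (p - u)]
  have hpk : p ≤ u + k + 1 := by linarith [Int.lt_floor_add_one (p - u)]
  have hcells : ∀ (n : ℕ) (q : ℝ), p ≤ q → q ≤ u + k + 1 + n →
      ‖∫ y in p..q, h y‖ ≤ κ * (n + 1) := by
    intro n
    induction n with
    | zero =>
      intro q hpq hq
      simpa using hcell k p q hkp hpq (by simpa using hq)
    | succ n ih =>
      intro q hpq hq
      push_cast at hq ⊢
      rcases le_total q (u + k + 1 + n) with hqn | hqn
      · exact (ih q hpq hqn).trans (by gcongr; linarith)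
      · have hpn : p ≤ u + k + 1 + n := hpk.trans (le_add_of_nonneg_right (Nat.cast_nonneg n))
        have hlast := hcell (k + 1 + n) (u + k + 1 + n) q (by push_cast; linarith) hqn
          (by push_cast; linarith)
        rw [← intervalIntegral.integral_add_adjacent_intervals (hint p (u + k + 1 + n)) (hint _ q)]
        linarith [norm_add_le (∫ y in p..u + k + 1 + n, h y) (∫ y in u + k + 1 + n..q, h y),
          ih _ hpn le_rfl]
  rw [abs_of_nonneg (sub_nonneg.2 hpq)]
  refine (hcells ⌈q - p⌉₊ q hpq ?_).trans (mul_le_mul_of_nonneg_left ?_ hκ)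
  · linarith [Nat.le_ceil (q - p)]
  · linarith [Nat.ceil_lt_add_one (sub_nonneg.2 hpq)]

/-- The arc of length `ℓ` starting at `u` on the circle `ℝ / ℤ`, as a `1`-periodic set of reals. -/
def arc (u ℓ : ℝ) : Set ℝ := {y | Int.fract (y - u) < ℓ}

theorem mem_arc {u ℓ y : ℝ} : y ∈ arc u ℓ ↔ Int.fract (y - u) < ℓ := Iff.rfl

theorem measurableSet_arc (u ℓ : ℝ) : MeasurableSet (arc u ℓ) :=
  measurableSet_lt (measurable_fract.comp (measurable_id.sub_const u)) measurable_const

theorem add_one_mem_arc {u ℓ y : ℝ} : y + 1 ∈ arc u ℓ ↔ y ∈ arc u ℓ := by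
  rw [mem_arc, mem_arc, add_sub_right_comm, Int.fract_add_one]

theorem mem_arc_iff_lt {u ℓ y : ℝ} {k : ℤ} (hky : u + k ≤ y) (hyk : y < u + k + 1) :
    y ∈ arc u ℓ ↔ y < u + k + ℓ := by
  rw [mem_arc, Int.fract, Int.floor_eq_iff.2 (show k ≤ y - u ∧ y - u < k + 1 by
    constructor <;> linarith), sub_sub, sub_lt_iff_lt_add']

theorem mem_arc_iff_fract_mem_Ico {u ℓ y : ℝ} (hu : 0 ≤ u) (hℓ : 0 ≤ ℓ) (huℓ : u + ℓ ≤ 1) :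
    y ∈ arc u ℓ ↔ Int.fract y ∈ Ico u (u + ℓ) := by
  have hy := Int.fract_add_floor y
  have hfract := Int.fract_lt_one y
  have hfract' := Int.fract_nonneg y
  rcases le_or_gt u (Int.fract y) with h | h
  · rw [mem_arc_iff_lt (k := ⌊y⌋) (by linarith) (by linarith), mem_Ico, and_iff_right h]
    constructor <;> intro <;> linarith
  · refine iff_of_false (fun hmem => ?_) fun hmem => h.not_ge hmem.1
    rw [mem_arc_iff_lt (k := ⌊y⌋ - 1) (by push_cast; linarith) (by push_cast; linarith)] at hmem
    push_cast at hmem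
    linarith

theorem norm_intervalIntegral_indicator_arc_le {E : Type*} [NormedAddCommGroup E]
    [NormedSpace ℝ E] {g : ℝ → E} {κ : ℝ} (hg : ∀ p q, IntervalIntegrable g volume p q)
    (hκ : ∀ p q, ‖∫ y in p..q, g y‖ ≤ κ) (u ℓ p q : ℝ) :
    ‖∫ y in p..q, (arc u ℓ).indicator g y‖ ≤ κ * (|q - p| + 2) := by
  have hint : ∀ p q, IntervalIntegrable ((arc u ℓ).indicator g) volume p q := fun p q =>
    intervalIntegrable_iff.2 ((intervalIntegrable_iff.1 (hg p q)).indicator (measurableSet_arc u ℓ))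
  refine norm_intervalIntegral_le_of_cells (u := u) hint (fun k p q hkp hpq hqk => ?_) p q
  set r := max p (min q (u + k + ℓ))
  have hpr : p ≤ r := le_max_left _ _
  have hrq : r ≤ q := max_le hpq (min_le_left _ _)
  have hinside : ∫ y in p..r, (arc u ℓ).indicator g y = ∫ y in p..r, g y :=
    intervalIntegral.integral_congr_Ioo_of_le hpr fun _ hy =>
      indicator_of_mem ((mem_arc_iff_lt (hkp.trans hy.1.le) (by linarith [hy.2])).2
        (((lt_max_iff.1 hy.2).resolve_left hy.1.not_gt).trans_le (min_le_right _ _))) g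
  have houtside : ∫ y in r..q, (arc u ℓ).indicator g y = ∫ _ in r..q, (0 : E) :=
    intervalIntegral.integral_congr_Ioo_of_le hrq fun y hy => by
      have hpy : p < y := hpr.trans_lt hy.1
      refine indicator_of_notMem (fun hmem => ?_) g
      have hlt := (mem_arc_iff_lt (hkp.trans hpy.le) (by linarith [hy.2])).1 hmem
      exact hy.1.not_ge ((le_min hy.2.le hlt.le).trans (le_max_right _ _))
  rw [← intervalIntegral.integral_add_adjacent_intervals (hint p r) (hint r q), hinside, houtside,
    intervalIntegral.integral_zero, add_zero]
  exact hκ p r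

/-- The centred indicator function of an arc. -/
noncomputable def arcDeviation (u ℓ y : ℝ) : ℝ := (arc u ℓ).indicator 1 y - ℓ

theorem measurable_arcDeviation (u ℓ : ℝ) : Measurable (arcDeviation u ℓ) :=
  (measurable_one.indicator (measurableSet_arc u ℓ)).sub_const ℓ

theorem indicator_arc_periodic (u ℓ : ℝ) :
    Function.Periodic ((arc u ℓ).indicator (1 : ℝ → ℝ)) 1 := fun y => by
  by_cases hy : y ∈ arc u ℓ
  · rw [indicator_of_mem hy, indicator_of_mem (add_one_mem_arc.2 hy), Pi.one_apply, Pi.one_apply]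
  · rw [indicator_of_notMem hy, indicator_of_notMem (mt add_one_mem_arc.1 hy)]

theorem arcDeviation_periodic (u ℓ : ℝ) : Function.Periodic (arcDeviation u ℓ) 1 := fun y => by
  rw [arcDeviation, indicator_arc_periodic, arcDeviation]

theorem abs_arcDeviation_le_one {u ℓ : ℝ} (hℓ₀ : 0 ≤ ℓ) (hℓ₁ : ℓ ≤ 1) (y : ℝ) :
    |arcDeviation u ℓ y| ≤ 1 := by
  rw [arcDeviation, abs_le]
  by_cases hy : y ∈ arc u ℓ
  · rw [indicator_of_mem hy, Pi.one_apply]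
    constructor <;> linarith
  · rw [indicator_of_notMem hy]
    constructor <;> linarith

theorem intervalIntegrable_indicator_arc (u ℓ p q : ℝ) :
    IntervalIntegrable ((arc u ℓ).indicator (1 : ℝ → ℝ)) volume p q :=
  intervalIntegrable_iff.2 ((intervalIntegrable_iff.1
    (intervalIntegrable_const (c := (1 : ℝ)))).indicator (measurableSet_arc u ℓ))

theorem intervalIntegrable_arcDeviation (u ℓ p q : ℝ) :
    IntervalIntegrable (arcDeviation u ℓ) volume p q :=
  (intervalIntegrable_indicator_arc u ℓ p q).sub intervalIntegrable_const

theorem intervalIntegral_indicator_arc {u ℓ : ℝ} (hℓ₀ : 0 ≤ ℓ) (hℓ₁ : ℓ ≤ 1) :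
    ∫ y in (0 : ℝ)..1, (arc u ℓ).indicator 1 y = ℓ := by
  have hinter : Ico u (u + 1) ∩ arc u ℓ = Ico u (u + ℓ) := by
    ext y
    simp only [mem_inter_iff, mem_Ico]
    constructor
    · rintro ⟨⟨huy, hyu⟩, hy⟩
      rw [mem_arc_iff_lt (k := 0) (by simpa using huy) (by simpa using hyu)] at hy
      exact ⟨huy, by simpa using hy⟩
    · rintro ⟨huy, hyu⟩
      have hy : y < u + 1 := by linarith
      exact ⟨⟨huy, hy⟩, (mem_arc_iff_lt (k := 0) (by simpa using huy) (by simpa using hy)).2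
        (by simpa using hyu)⟩
  have hshift := (indicator_arc_periodic u ℓ).intervalIntegral_add_eq 0 u
  rw [zero_add] at hshift
  rw [hshift, intervalIntegral.integral_of_le (by linarith), ← integral_Ico_eq_integral_Ioc,
    setIntegral_indicator (measurableSet_arc u ℓ), hinter]
  simp [hℓ₀]

theorem intervalIntegral_arcDeviation {u ℓ : ℝ} (hℓ₀ : 0 ≤ ℓ) (hℓ₁ : ℓ ≤ 1) :
    ∫ y in (0 : ℝ)..1, arcDeviation u ℓ y = 0 := by
  simp only [arcDeviation]
  rw [intervalIntegral.integral_sub (intervalIntegrable_indicator_arc u ℓ 0 1)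
    intervalIntegrable_const, intervalIntegral_indicator_arc hℓ₀ hℓ₁]
  simp

theorem intervalIntegral_abs_arcDeviation_le {u ℓ : ℝ} (hℓ₀ : 0 ≤ ℓ) (hℓ₁ : ℓ ≤ 1) :
    ∫ y in (0 : ℝ)..1, |arcDeviation u ℓ y| ≤ 2 * ℓ := by
  have hle : ∀ y, |arcDeviation u ℓ y| ≤ (arc u ℓ).indicator 1 y + ℓ := fun y => by
    rw [arcDeviation]
    refine (abs_sub _ _).trans (le_of_eq ?_)
    rw [abs_of_nonneg (indicator_nonneg (f := 1) (fun _ _ => zero_le_one) y), abs_of_nonneg hℓ₀]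
  have hi := intervalIntegrable_indicator_arc u ℓ 0 1
  calc ∫ y in (0 : ℝ)..1, |arcDeviation u ℓ y|
      ≤ ∫ y in (0 : ℝ)..1, ((arc u ℓ).indicator 1 y + ℓ) :=
        intervalIntegral.integral_mono zero_le_one (intervalIntegrable_arcDeviation u ℓ 0 1).abs
          (hi.add intervalIntegrable_const) hle
    _ = 2 * ℓ := by
        rw [intervalIntegral.integral_add hi intervalIntegrable_const,
          intervalIntegral_indicator_arc hℓ₀ hℓ₁]
        simp
        ring

theorem abs_intervalIntegral_arcDeviation_comp_mul_le {u ℓ : ℝ} (hℓ₀ : 0 ≤ ℓ) (hℓ₁ : ℓ ≤ 1)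
    {c : ℝ} (hc : c ≠ 0) (p q : ℝ) :
    |∫ y in p..q, arcDeviation u ℓ (c * y)| ≤ 2 * ℓ / |c| := by
  have hperiodic := norm_intervalIntegral_comp_mul_le_of_periodic (arcDeviation_periodic u ℓ)
    one_pos (intervalIntegrable_arcDeviation u ℓ 0 1) (intervalIntegral_arcDeviation hℓ₀ hℓ₁) hc p q
  refine hperiodic.trans ?_
  rw [div_eq_inv_mul]
  exact mul_le_mul_of_nonneg_left (intervalIntegral_abs_arcDeviation_le hℓ₀ hℓ₁) (by positivity)

section Integrable

variable {μ : Measure ℝ} [IsFiniteMeasure μ] {u ℓ : ℝ}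

theorem integrable_arcDeviation_comp_mul (hℓ₀ : 0 ≤ ℓ) (hℓ₁ : ℓ ≤ 1) (c : ℝ) :
    Integrable (fun x => arcDeviation u ℓ (c * x)) μ :=
  .of_bound ((measurable_arcDeviation u ℓ).comp (measurable_const_mul c)).aestronglyMeasurable 1
    (ae_of_all _ fun x => abs_arcDeviation_le_one hℓ₀ hℓ₁ (c * x))

theorem integrable_arcDeviation_mul (hℓ₀ : 0 ≤ ℓ) (hℓ₁ : ℓ ≤ 1) (b c : ℝ) :
    Integrable (fun x => arcDeviation u ℓ (b * x) * arcDeviation u ℓ (c * x)) μ :=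
  (integrable_arcDeviation_comp_mul hℓ₀ hℓ₁ c).bdd_mul (c := 1)
    (integrable_arcDeviation_comp_mul hℓ₀ hℓ₁ b).aestronglyMeasurable
    (ae_of_all _ fun x => abs_arcDeviation_le_one hℓ₀ hℓ₁ (b * x))

end Integrable

theorem abs_intervalIntegral_indicator_arc_mul_le {u ℓ : ℝ} (hℓ₀ : 0 ≤ ℓ) (hℓ₁ : ℓ ≤ 1)
    {b c : ℝ} (hb : b ≠ 0) (hc : c ≠ 0) (p q : ℝ) :
    |∫ x in p..q, (arc u ℓ).indicator 1 (b * x) * arcDeviation u ℓ (c * x)|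
      ≤ 2 * ℓ / |c| * (|b| * |q - p| + 2) := by
  have hsubst : ∫ x in p..q, (arc u ℓ).indicator 1 (b * x) * arcDeviation u ℓ (c * x)
      = b⁻¹ * ∫ y in b * p..b * q,
          (arc u ℓ).indicator (fun y => arcDeviation u ℓ (c / b * y)) y := by
    rw [← smul_eq_mul, ← intervalIntegral.integral_comp_mul_left _ hb]
    refine intervalIntegral.integral_congr fun x _ => ?_
    by_cases hx : b * x ∈ arc u ℓ
    · simp only [indicator_of_mem hx, Pi.one_apply, one_mul]
      congr 1
      field_simp
    · simp only [indicator_of_notMem hx, zero_mul]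
  have hbound := norm_intervalIntegral_indicator_arc_le (g := fun y => arcDeviation u ℓ (c / b * y))
    (fun p q => ⟨integrable_arcDeviation_comp_mul hℓ₀ hℓ₁ (c / b),
      integrable_arcDeviation_comp_mul hℓ₀ hℓ₁ (c / b)⟩)
    (abs_intervalIntegral_arcDeviation_comp_mul_le hℓ₀ hℓ₁ (div_ne_zero hc hb)) u ℓ (b * p) (b * q)
  rw [Real.norm_eq_abs, ← mul_sub, abs_mul b, abs_div c] at hbound
  rw [hsubst, abs_mul, abs_inv, inv_mul_le_iff₀ (abs_pos.2 hb)]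
  refine hbound.trans (le_of_eq ?_)
  have := abs_pos.2 hb
  have := abs_pos.2 hc
  field_simp

theorem abs_intervalIntegral_arcDeviation_mul_le {u ℓ : ℝ} (hℓ₀ : 0 ≤ ℓ) (hℓ₁ : ℓ ≤ 1)
    {b c : ℝ} (hb : b ≠ 0) (hc : c ≠ 0) (p q : ℝ) :
    |∫ x in p..q, arcDeviation u ℓ (b * x) * arcDeviation u ℓ (c * x)|
      ≤ 2 * ℓ / |c| * (|b| * |q - p| + 3) := by
  have hdev : IntervalIntegrable (fun x => arcDeviation u ℓ (c * x)) volume p q :=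
    ⟨integrable_arcDeviation_comp_mul hℓ₀ hℓ₁ c, integrable_arcDeviation_comp_mul hℓ₀ hℓ₁ c⟩
  have hmul : IntervalIntegrable
      (fun x => arcDeviation u ℓ (b * x) * arcDeviation u ℓ (c * x)) volume p q :=
    ⟨integrable_arcDeviation_mul hℓ₀ hℓ₁ b c, integrable_arcDeviation_mul hℓ₀ hℓ₁ b c⟩
  have hsplit : ∫ x in p..q, (arc u ℓ).indicator 1 (b * x) * arcDeviation u ℓ (c * x)
      = (∫ x in p..q, arcDeviation u ℓ (b * x) * arcDeviation u ℓ (c * x))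
        + ℓ * ∫ x in p..q, arcDeviation u ℓ (c * x) := by
    rw [← intervalIntegral.integral_const_mul, ← intervalIntegral.integral_add hmul
      (hdev.const_mul ℓ)]
    refine intervalIntegral.integral_congr fun x _ => ?_
    simp only [arcDeviation]
    ring
  have harc := abs_intervalIntegral_indicator_arc_mul_le (u := u) hℓ₀ hℓ₁ hb hc p q
  have hsingle := abs_intervalIntegral_arcDeviation_comp_mul_le (u := u) hℓ₀ hℓ₁ hc p q
  rw [eq_sub_of_add_eq hsplit.symm]
  calc _ ≤ 2 * ℓ / |c| * (|b| * |q - p| + 2) + ℓ * (2 * ℓ / |c|) := by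
        refine (abs_sub _ _).trans (add_le_add harc ?_)
        rw [abs_mul, abs_of_nonneg hℓ₀]
        exact mul_le_mul_of_nonneg_left hsingle hℓ₀
    _ ≤ 2 * ℓ / |c| * (|b| * |q - p| + 2) + 1 * (2 * ℓ / |c|) := by gcongr
    _ = 2 * ℓ / |c| * (|b| * |q - p| + 3) := by ring

/-! ### Correlations along lacunary sequences -/

theorem sum_pow_sub_le {r : ℝ} (hr₀ : 0 ≤ r) (hr₁ : r < 1) (N : ℕ) :
    ∑ m ∈ Finset.range (N + 1), r ^ (N - m) ≤ (1 - r)⁻¹ := by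
  rw [← tsum_geometric_of_lt_one hr₀ hr₁, ← Finset.sum_range_reflect]
  refine le_of_eq_of_le (Finset.sum_congr rfl fun m hm => ?_)
    ((summable_geometric_of_lt_one hr₀ hr₁).sum_le_tsum (Finset.range (N + 1))
      fun m _ => pow_nonneg hr₀ m)
  rw [Finset.mem_range] at hm
  congr 1
  omega

theorem integral_sq_sum_le_of_correlation_le {Ω : Type*} [MeasurableSpace Ω] {μ : Measure Ω}
    {X : ℕ → Ω → ℝ} {K r : ℝ} (hr₀ : 0 ≤ r) (hr₁ : r < 1)
    (hX : ∀ m n, Integrable (fun x => X m x * X n x) μ)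
    (hcorr : ∀ m n, m ≤ n → ∫ x, X m x * X n x ∂μ ≤ K * r ^ (n - m)) (N : ℕ) :
    ∫ x, (∑ n ∈ Finset.range N, X n x) ^ 2 ∂μ ≤ 2 * K * (1 - r)⁻¹ * N := by
  have hK : 0 ≤ K := by
    simpa using (integral_nonneg fun x => mul_self_nonneg (X 0 x)).trans (hcorr 0 0 le_rfl)
  have hsq : ∀ N, Integrable (fun x => (∑ n ∈ Finset.range N, X n x) ^ 2) μ := fun N => by
    simp only [sq, Finset.sum_mul_sum]
    exact integrable_finsetSum _ fun m _ => integrable_finsetSum _ fun n _ => hX m n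
  induction N with
  | zero => simp
  | succ N ih =>
    have hcross : Integrable (fun x => ∑ m ∈ Finset.range (N + 1), X m x * X N x) μ :=
      integrable_finsetSum _ fun m _ => hX m N
    have hexpand : ∀ x, (∑ n ∈ Finset.range (N + 1), X n x) ^ 2
        ≤ (∑ n ∈ Finset.range N, X n x) ^ 2 + 2 * ∑ m ∈ Finset.range (N + 1), X m x * X N x := by
      intro x
      rw [← Finset.sum_mul, Finset.sum_range_succ]
      nlinarith [sq_nonneg (X N x)]
    calc ∫ x, (∑ n ∈ Finset.range (N + 1), X n x) ^ 2 ∂μ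
        ≤ ∫ x, ((∑ n ∈ Finset.range N, X n x) ^ 2
            + 2 * ∑ m ∈ Finset.range (N + 1), X m x * X N x) ∂μ :=
          integral_mono (hsq _) ((hsq N).add (hcross.const_mul 2)) hexpand
      _ = ∫ x, (∑ n ∈ Finset.range N, X n x) ^ 2 ∂μ
            + 2 * ∑ m ∈ Finset.range (N + 1), ∫ x, X m x * X N x ∂μ := by
          rw [integral_add (hsq N) (hcross.const_mul 2), integral_const_mul,
            integral_finsetSum _ fun m _ => hX m N]
      _ ≤ 2 * K * (1 - r)⁻¹ * N + 2 * ∑ m ∈ Finset.range (N + 1), K * r ^ (N - m) := by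
          gcongr with m hm
          exact hcorr m N (Finset.mem_range_succ_iff.1 hm)
      _ ≤ 2 * K * (1 - r)⁻¹ * N + 2 * (K * (1 - r)⁻¹) := by
          rw [← Finset.mul_sum]
          gcongr
          exact sum_pow_sub_le hr₀ hr₁ N
      _ = 2 * K * (1 - r)⁻¹ * (N + 1 : ℕ) := by
          push_cast
          ring

/-- A sequence of nonzero reals that is lacunary in the sense of Hadamard, with ratio `q`. -/
structure IsLacunary (q : ℝ) (a : ℕ → ℝ) : Prop where
  one_lt : 1 < q
  apply_zero_ne_zero : a 0 ≠ 0
  mul_abs_le : ∀ n, q * |a n| ≤ |a (n + 1)|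

theorem isLacunary_pow {α : ℝ} (hα : 1 < |α|) : IsLacunary |α| (α ^ ·) where
  one_lt := hα
  apply_zero_ne_zero := by simp
  mul_abs_le n := by rw [pow_succ', abs_mul]

namespace IsLacunary

variable {q : ℝ} {a : ℕ → ℝ} (ha : IsLacunary q a)

include ha

theorem pow_mul_abs_le {m n : ℕ} (hmn : m ≤ n) : q ^ (n - m) * |a m| ≤ |a n| := by
  induction n, hmn using Nat.le_induction with
  | base => simp
  | succ n hmn ih =>
    rw [Nat.sub_add_comm hmn, pow_succ', mul_assoc]
    exact (mul_le_mul_of_nonneg_left ih (zero_le_one.trans ha.one_lt.le)).trans (ha.mul_abs_le n)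

theorem abs_zero_le (n : ℕ) : |a 0| ≤ |a n| :=
  (le_mul_of_one_le_left (abs_nonneg _) (one_le_pow₀ ha.one_lt.le)).trans
    (ha.pow_mul_abs_le (Nat.zero_le n))

theorem ne_zero (n : ℕ) : a n ≠ 0 :=
  abs_pos.1 ((abs_pos.2 ha.apply_zero_ne_zero).trans_le (ha.abs_zero_le n))

theorem correlation_arcDeviation_le {u ℓ : ℝ} (hℓ₀ : 0 ≤ ℓ) (hℓ₁ : ℓ ≤ 1) (s t : ℝ) {m n : ℕ}
    (hmn : m ≤ n) :
    |∫ x in s..t, arcDeviation u ℓ (a m * x) * arcDeviation u ℓ (a n * x)|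
      ≤ 2 * ℓ * (|t - s| + 3 / |a 0|) * q⁻¹ ^ (n - m) := by
  have h₀ : 0 < |a 0| := abs_pos.2 ha.apply_zero_ne_zero
  have hm : 0 < |a m| := abs_pos.2 (ha.ne_zero m)
  have hn : 0 < |a n| := abs_pos.2 (ha.ne_zero n)
  have hq : 0 < q := zero_lt_one.trans ha.one_lt
  have hratio : |a m| / |a n| ≤ q⁻¹ ^ (n - m) := by
    rw [div_le_iff₀ hn, inv_pow, le_inv_mul_iff₀ (by positivity)]
    exact ha.pow_mul_abs_le hmn
  calc _ ≤ 2 * ℓ / |a n| * (|a m| * |t - s| + 3) :=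
        abs_intervalIntegral_arcDeviation_mul_le hℓ₀ hℓ₁ (ha.ne_zero m) (ha.ne_zero n) s t
    _ = 2 * ℓ * (|t - s| + 3 / |a m|) * (|a m| / |a n|) := by field_simp
    _ ≤ 2 * ℓ * (|t - s| + 3 / |a 0|) * q⁻¹ ^ (n - m) := by
        have := ha.abs_zero_le m
        gcongr

theorem integral_sq_sum_arcDeviation_le {u ℓ : ℝ} (hℓ₀ : 0 ≤ ℓ) (hℓ₁ : ℓ ≤ 1) (k : ℤ) (N : ℕ) :
    ∫ x in Ioc (k : ℝ) (k + 1), (∑ n ∈ Finset.range N, arcDeviation u ℓ (a n * x)) ^ 2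
      ≤ 4 * (1 + 3 / |a 0|) * (1 - q⁻¹)⁻¹ * (ℓ * N) := by
  have hq : 0 < q := zero_lt_one.trans ha.one_lt
  refine (integral_sq_sum_le_of_correlation_le (K := 2 * ℓ * (1 + 3 / |a 0|))
    (inv_nonneg.2 hq.le) (inv_lt_one_of_one_lt₀ ha.one_lt)
    (fun m n => integrable_arcDeviation_mul hℓ₀ hℓ₁ (a m) (a n)) (fun m n hmn => ?_) N).trans
    (le_of_eq (by ring))
  rw [← intervalIntegral.integral_of_le (by linarith)]
  simpa using (le_abs_self _).trans (ha.correlation_arcDeviation_le hℓ₀ hℓ₁ (k : ℝ) (k + 1) hmn)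

end IsLacunary

/-! ### Visits to arcs -/

theorem ae_summable_of_summable_integral {Ω ι : Type*} [MeasurableSpace Ω] {μ : Measure Ω}
    [Countable ι] {g : ι → Ω → ℝ} (hg : ∀ i x, 0 ≤ g i x) (hint : ∀ i, Integrable (g i) μ)
    (hsum : Summable fun i => ∫ x, g i x ∂μ) : ∀ᵐ x ∂μ, Summable fun i => g i x := by
  have hnorm : ∀ i, eLpNorm (g i) 1 μ = ENNReal.ofReal (∫ x, g i x ∂μ) := fun i => by
    rw [eLpNorm_one_eq_lintegral_enorm, ofReal_integral_eq_lintegral_ofReal (hint i)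
      (ae_of_all _ (hg i))]
    exact lintegral_congr fun x => Real.enorm_of_nonneg (hg i x)
  have hae := summable_norm_of_tsum_eLpNorm_ne_top le_rfl (fun i => (hint i).aestronglyMeasurable)
    (by simpa only [hnorm] using hsum.tsum_ofReal_ne_top)
  filter_upwards [hae] with x hx
  simpa only [Real.norm_of_nonneg (hg _ x)] using hx

/-- The number of visits to `A` among the first `N` terms of the sequence `w`. -/
noncomputable def visits (A : Set ℝ) (w : ℕ → ℝ) (N : ℕ) : ℝ :=
  ∑ n ∈ Finset.range N, A.indicator 1 (w n)

theorem visits_mono (A : Set ℝ) (w : ℕ → ℝ) : Monotone (visits A w) := fun _ _ hMN =>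
  Finset.sum_le_sum_of_subset_of_nonneg (Finset.range_subset_range.2 hMN)
    fun _ _ _ => indicator_nonneg (fun _ _ => zero_le_one) _

theorem visits_le_of_visits_sq_le {A : Set ℝ} {w : ℕ → ℝ} {B : ℝ} (hB : 0 ≤ B)
    (h : ∀ j : ℕ, 0 < j → visits A w (j ^ 2) ≤ B * j ^ 2) (N : ℕ) :
    visits A w N ≤ 4 * B * N := by
  rcases Nat.eq_zero_or_pos N with rfl | hN
  · simp [visits]
  have hj : N ≤ (N.sqrt + 1) ^ 2 := (Nat.lt_succ_sqrt' N).le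
  have hj' : ((N.sqrt + 1 : ℕ) : ℝ) ^ 2 ≤ 4 * N := by
    have h : (N.sqrt + 1) ^ 2 ≤ 4 * N := by nlinarith [Nat.sqrt_pos.2 hN, Nat.sqrt_le' N]
    exact_mod_cast h
  calc visits A w N ≤ visits A w ((N.sqrt + 1) ^ 2) := visits_mono _ _ hj
    _ ≤ B * (4 * N) := (h _ N.sqrt.succ_pos).trans (by gcongr)
    _ = 4 * B * N := by ring

theorem sum_arcDeviation (u ℓ : ℝ) (w : ℕ → ℝ) (N : ℕ) :
    ∑ n ∈ Finset.range N, arcDeviation u ℓ (w n) = visits (arc u ℓ) w N - N * ℓ := by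
  simp [arcDeviation, visits]

theorem IsLacunary.ae_summable_sq_arcDeviation {ι : Type*} [Countable ι] {q : ℝ} {a : ℕ → ℝ}
    (ha : IsLacunary q a) {u ℓ c : ι → ℝ} (hℓ₀ : ∀ i, 0 ≤ ℓ i) (hℓ₁ : ∀ i, ℓ i ≤ 1)
    (hc : Summable fun i => c i ^ 2 * ℓ i) :
    ∀ᵐ x : ℝ, Summable fun p : ι × ℕ => (c p.1 *
      ((∑ n ∈ Finset.range (p.2 ^ 2),
        arcDeviation (u p.1) (ℓ p.1) (a n * x)) / (p.2 : ℝ) ^ 2)) ^ 2 := by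
  rw [← Measure.restrict_univ (μ := (volume : Measure ℝ)), ← iUnion_Ioc_intCast ℝ,
    ae_restrict_iUnion_iff]
  intro k
  set K := 4 * (1 + 3 / |a 0|) * (1 - q⁻¹)⁻¹
  have hsq : ∀ (i : ι) (N : ℕ), Integrable
      (fun x => (∑ n ∈ Finset.range N, arcDeviation (u i) (ℓ i) (a n * x)) ^ 2)
      (volume.restrict (Ioc (k : ℝ) (k + 1))) := fun i N => by
    simp only [sq, Finset.sum_mul_sum]
    exact integrable_finsetSum _ fun m _ => integrable_finsetSum _ fun n _ =>
      integrable_arcDeviation_mul (hℓ₀ i) (hℓ₁ i) (a m) (a n)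
  have hsum : Summable fun p : ι × ℕ => c p.1 ^ 2 * ℓ p.1 * (1 / (p.2 : ℝ) ^ 2) :=
    hc.mul_of_nonneg (Real.summable_one_div_nat_pow.2 one_lt_two)
      (fun i => mul_nonneg (sq_nonneg _) (hℓ₀ i)) fun j => by positivity
  refine ae_summable_of_summable_integral (fun p x => sq_nonneg _) (fun p => ?_)
    ((hsum.mul_left K).of_nonneg_of_le (fun p => integral_nonneg fun x => sq_nonneg _)
      fun p => ?_)
  · simp only [mul_pow, div_pow]
    exact ((hsq p.1 (p.2 ^ 2)).div_const _).const_mul _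
  · obtain ⟨i, j⟩ := p
    simp only [mul_pow, div_pow, integral_const_mul, integral_div]
    have hj : ((j ^ 2 : ℕ) : ℝ) / ((j : ℝ) ^ 2) ^ 2 = 1 / (j : ℝ) ^ 2 := by
      rcases eq_or_ne j 0 with rfl | hj
      · simp
      · push_cast
        field_simp
    calc c i ^ 2 * ((∫ x in Ioc (k : ℝ) (k + 1),
          (∑ n ∈ Finset.range (j ^ 2), arcDeviation (u i) (ℓ i) (a n * x)) ^ 2) / ((j : ℝ) ^ 2) ^ 2)
        ≤ c i ^ 2 * (K * (ℓ i * (j ^ 2 : ℕ)) / ((j : ℝ) ^ 2) ^ 2) := by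
          gcongr
          exact ha.integral_sq_sum_arcDeviation_le (hℓ₀ i) (hℓ₁ i) k (j ^ 2)
      _ = K * (c i ^ 2 * ℓ i * (1 / (j : ℝ) ^ 2)) := by
          rw [← hj]
          ring

theorem eventually_succ_sq_le {c : ℝ} (hc : 1 < c) :
    ∀ᶠ j : ℕ in atTop, (((j + 1) ^ 2 : ℕ) : ℝ) ≤ c * ((j ^ 2 : ℕ) : ℝ) := by
  have h : ∀ᶠ j : ℕ in atTop, 3 / (c - 1) ≤ j :=
    tendsto_natCast_atTop_atTop.eventually_ge_atTop _
  filter_upwards [h, eventually_ge_atTop 1] with j hj hj₁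
  have hj₁' : (1 : ℝ) ≤ j := by exact_mod_cast hj₁
  rw [div_le_iff₀ (by linarith)] at hj
  push_cast
  nlinarith

/-- The sequence `w` is uniformly distributed modulo `1`, tested on the arcs
`[i / n, (i + 1) / n)`, which suffices for Riemann sums over uniform partitions. -/
def IsEquidistributed (w : ℕ → ℝ) : Prop :=
  ∀ (n : ℕ) (i : Fin n),
    Tendsto (fun N : ℕ => visits (arc (i / n) (1 / n)) w N / N) atTop (𝓝 (1 / n))

namespace IsLacunary

variable {q : ℝ} {a : ℕ → ℝ} (ha : IsLacunary q a)

include ha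

theorem ae_tendsto_visits_arc_div {ℓ : ℝ} (hℓ₀ : 0 ≤ ℓ) (hℓ₁ : ℓ ≤ 1) (u : ℝ) :
    ∀ᵐ x : ℝ, Tendsto (fun N : ℕ => visits (arc u ℓ) (fun n => a n * x) N / N) atTop (𝓝 ℓ) := by
  filter_upwards [ha.ae_summable_sq_arcDeviation (ι := Unit) (u := fun _ => u) (ℓ := fun _ => ℓ)
    (c := fun _ => 1) (fun _ => hℓ₀) (fun _ => hℓ₁) .of_finite] with x hx
  refine tendsto_div_of_monotone_of_exists_subseq_tendsto_div _ ℓ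
    (visits_mono _ _) fun c hc =>
      ⟨(· ^ 2), eventually_succ_sq_le hc, tendsto_pow_atTop two_ne_zero, ?_⟩
  have hsq := (hx.comp_injective (Prod.mk_right_injective ())).tendsto_atTop_zero
  have habs := hsq.sqrt
  simp only [Function.comp_apply, one_mul, Real.sqrt_sq_eq_abs, Real.sqrt_zero] at habs
  have hlim := ((tendsto_zero_iff_abs_tendsto_zero _).2 habs).add_const ℓ
  rw [zero_add] at hlim
  refine hlim.congr' ?_
  filter_upwards [eventually_ne_atTop 0] with j hj
  rw [sum_arcDeviation, Nat.cast_pow, sub_div, mul_div_cancel_left₀ _ (by positivity),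
    sub_add_cancel]

theorem ae_isEquidistributed : ∀ᵐ x : ℝ, IsEquidistributed fun n => a n * x := by
  simp only [IsEquidistributed, ae_all_iff]
  intro n i
  have hn : (1 : ℝ) ≤ n := by exact_mod_cast i.pos
  exact ha.ae_tendsto_visits_arc_div (by positivity) (div_le_one_of_le₀ hn (by positivity)) _

theorem ae_exists_visits_arc_le {ι : Type*} [Countable ι] {u ℓ c : ι → ℝ}
    (hℓ₀ : ∀ i, 0 ≤ ℓ i) (hℓ₁ : ∀ i, ℓ i ≤ 1) (hc₀ : ∀ i, 0 < c i)
    (hc : Summable fun i => c i ^ 2 * ℓ i) :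
    ∀ᵐ x : ℝ, ∃ C, 0 ≤ C ∧ ∀ i (N : ℕ),
      visits (arc (u i) (ℓ i)) (fun n => a n * x) N ≤ C * (ℓ i + (c i)⁻¹) * N := by
  filter_upwards [ha.ae_summable_sq_arcDeviation (u := u) hℓ₀ hℓ₁ hc] with x hx
  obtain ⟨S, hS, hdev⟩ : ∃ S, 0 ≤ S ∧ ∀ i (j : ℕ),
      c i * ((visits (arc (u i) (ℓ i)) (fun n => a n * x) (j ^ 2) - (j ^ 2 : ℕ) * ℓ i) / j ^ 2)
        ≤ S := by
    simp only [← sum_arcDeviation]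
    exact ⟨_, Real.sqrt_nonneg _, fun i j => (le_abs_self _).trans
      (Real.abs_le_sqrt (hx.le_tsum (i, j) fun p _ => sq_nonneg _))⟩
  have hsquares : ∀ i (j : ℕ), 0 < j → visits (arc (u i) (ℓ i)) (fun n => a n * x) (j ^ 2)
      ≤ (ℓ i + S * (c i)⁻¹) * j ^ 2 := fun i j hj => by
    have h := hdev i j
    rw [← le_div_iff₀' (hc₀ i), div_le_iff₀ (by positivity), div_eq_mul_inv S] at h
    push_cast at h
    linarith
  refine ⟨4 * (1 + S), by positivity, fun i N => ?_⟩
  have hℓ := hℓ₀ i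
  have hci := (hc₀ i).le
  calc visits (arc (u i) (ℓ i)) (fun n => a n * x) N
      ≤ 4 * (ℓ i + S * (c i)⁻¹) * N := visits_le_of_visits_sq_le (by positivity) (hsquares i) N
    _ ≤ 4 * ((1 + S) * (ℓ i + (c i)⁻¹)) * N := by
        have : 0 ≤ S * ℓ i + (c i)⁻¹ := by positivity
        gcongr
        linarith
    _ = 4 * (1 + S) * (ℓ i + (c i)⁻¹) * N := by ring

end IsLacunary

/-! ### Distance to a point -/

theorem mem_arc_of_norm_sub_le {y z t : ℝ} (ht : 0 < t)
    (hy : ‖((y - z : ℝ) : UnitAddCircle)‖ ≤ t) : y ∈ arc (z - t) (min 1 (3 * t)) := by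
  rcases le_total 1 (3 * t) with h | h
  · rw [min_eq_left h, mem_arc]
    exact Int.fract_lt_one _
  · rw [UnitAddCircle.norm_eq, abs_le] at hy
    rw [min_eq_right h, mem_arc_iff_lt (k := round (y - z))] <;> linarith

theorem norm_sub_le_abs_fract_sub (y z : ℝ) :
    ‖((y - z : ℝ) : UnitAddCircle)‖ ≤ |Int.fract y - z| := by
  rw [UnitAddCircle.norm_eq, Int.fract, sub_right_comm y (⌊y⌋ : ℝ)]
  exact round_le (y - z) ⌊y⌋

theorem visits_eq_card (A : Set ℝ) (w : ℕ → ℝ) [DecidablePred (w · ∈ A)] (N : ℕ) :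
    visits A w N = ((Finset.range N).filter (w · ∈ A)).card := by
  simp only [visits, indicator_apply]
  rw [Finset.card_filter]
  push_cast
  refine Finset.sum_congr rfl fun n _ => ?_
  split_ifs <;> rfl

theorem IsLacunary.ae_exists_card_norm_sub_le {q : ℝ} {a : ℕ → ℝ} (ha : IsLacunary q a) (z : ℝ)
    {t : ℝ} (ht₀ : 0 < t) (ht : 1 / 2 < t ^ 2) :
    ∀ᵐ x : ℝ, ∃ C, 0 ≤ C ∧ ∀ k N : ℕ,
      (((Finset.range N).filter fun n =>
        ‖((a n * x - z : ℝ) : UnitAddCircle)‖ ≤ (1 / 2) ^ k).card : ℝ) ≤ C * t ^ k * N := by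
  have hℓ : ∀ k : ℕ, (0 : ℝ) ≤ min 1 (3 * (1 / 2) ^ k) := fun k => by positivity
  have hsum : Summable fun k : ℕ => (t⁻¹ ^ k) ^ 2 * min 1 (3 * (1 / 2) ^ k) := by
    have hratio : 1 / 2 / t ^ 2 < 1 := (div_lt_one (by positivity)).2 ht
    refine ((summable_geometric_of_lt_one (by positivity) hratio).mul_left 3).of_nonneg_of_le
      (fun k => mul_nonneg (by positivity) (hℓ k)) fun k => ?_
    calc (t⁻¹ ^ k) ^ 2 * min 1 (3 * (1 / 2) ^ k)
        ≤ (t⁻¹ ^ k) ^ 2 * (3 * (1 / 2) ^ k) := by gcongr; exact min_le_right _ _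
      _ = 3 * (1 / 2 / t ^ 2) ^ k := by
          rw [mul_left_comm, ← pow_mul, mul_comm k 2, pow_mul, ← mul_pow, inv_pow, inv_mul_eq_div]
  filter_upwards [ha.ae_exists_visits_arc_le (u := fun k : ℕ => z - (1 / 2) ^ k) hℓ
    (fun k => min_le_left _ _) (fun k => by positivity) hsum] with x ⟨C, hC, hvisits⟩
  refine ⟨C * 4, by positivity, fun k N => ?_⟩
  have hcard : (((Finset.range N).filter fun n =>
      ‖((a n * x - z : ℝ) : UnitAddCircle)‖ ≤ (1 / 2) ^ k).card : ℝ)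
      ≤ visits (arc (z - (1 / 2) ^ k) (min 1 (3 * (1 / 2) ^ k))) (fun n => a n * x) N := by
    classical
    rw [visits_eq_card]
    gcongr
    exact mem_arc_of_norm_sub_le (by positivity)
  have hscale : min 1 (3 * (1 / 2) ^ k) + (t⁻¹ ^ k)⁻¹ ≤ 4 * t ^ k := by
    have htk : (1 / 2 : ℝ) ^ k ≤ t ^ k := pow_le_pow_left₀ (by norm_num) (by nlinarith) k
    rw [inv_pow, inv_inv]
    linarith [min_le_right 1 (3 * (1 / 2 : ℝ) ^ k)]
  calc _ ≤ C * (min 1 (3 * (1 / 2) ^ k) + (t⁻¹ ^ k)⁻¹) * N := hcard.trans (hvisits k N)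
    _ ≤ C * (4 * t ^ k) * N := by gcongr
    _ = C * 4 * t ^ k * N := by ring

theorem pos_of_card_le {d : ℕ → ℝ} {C t : ℝ} (hd : ∀ n, 0 ≤ d n) (ht₀ : 0 ≤ t) (ht₁ : t < 1)
    (hcard : ∀ k N : ℕ,
      (((Finset.range N).filter fun n => d n ≤ (1 / 2) ^ k).card : ℝ) ≤ C * t ^ k * N) (n : ℕ) :
    0 < d n := by
  refine (hd n).lt_of_ne' fun hn => ?_
  have hone : ∀ k : ℕ, 1 ≤ C * t ^ k * (n + 1 : ℕ) := fun k => by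
    refine le_trans ?_ (hcard k (n + 1))
    rw [Nat.one_le_cast, Nat.one_le_iff_ne_zero, Finset.card_ne_zero]
    exact ⟨n, by simp [hn]⟩
  have hlim := ((tendsto_pow_atTop_nhds_zero_of_lt_one ht₀ ht₁).const_mul C).mul_const
    ((n + 1 : ℕ) : ℝ)
  rw [mul_zero, zero_mul] at hlim
  exact one_pos.not_ge (ge_of_tendsto' hlim hone)

theorem sum_rpow_neg_le_of_card_le {d : ℕ → ℝ} {C t γ : ℝ} (hd₀ : ∀ n, 0 < d n)
    (hd₁ : ∀ n, d n ≤ 1) (hC : 0 ≤ C) (ht : 0 ≤ t) (hγ : 0 ≤ γ) (hγt : 2 ^ γ * t < 1)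
    (hcard : ∀ k N : ℕ,
      (((Finset.range N).filter fun n => d n ≤ (1 / 2) ^ k).card : ℝ) ≤ C * t ^ k * N) (N : ℕ) :
    ∑ n ∈ Finset.range N, d n ^ (-γ) ≤ C * 2 ^ γ * (1 - 2 ^ γ * t)⁻¹ * N := by
  choose k hk using fun n => exists_nat_pow_near_of_lt_one (hd₀ n) (hd₁ n)
    (one_half_pos (α := ℝ)) one_half_lt_one
  have hterm : ∀ n, d n ^ (-γ) ≤ (2 ^ γ) ^ (k n + 1) := fun n => by
    have h := Real.rpow_le_rpow_of_nonpos (by positivity) (hk n).1.le (neg_nonpos.2 hγ)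
    refine h.trans (le_of_eq ?_)
    rw [← Real.rpow_natCast, ← Real.rpow_natCast, ← Real.rpow_mul (by norm_num),
      ← Real.rpow_mul (by norm_num), one_div, Real.inv_rpow (by norm_num), ← Real.rpow_neg
      (by norm_num)]
    congr 1
    ring
  have hθ : (0 : ℝ) ≤ 2 ^ γ * t := by positivity
  calc ∑ n ∈ Finset.range N, d n ^ (-γ)
      ≤ ∑ n ∈ Finset.range N, ((2 : ℝ) ^ γ) ^ (k n + 1) := Finset.sum_le_sum fun n _ => hterm n
    _ = ∑ j ∈ (Finset.range N).image k,
          ((Finset.range N).filter fun n => k n = j).card • ((2 : ℝ) ^ γ) ^ (j + 1) :=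
        Finset.sum_comp (fun j => ((2 : ℝ) ^ γ) ^ (j + 1)) k
    _ ≤ ∑ j ∈ (Finset.range N).image k, C * t ^ j * N * ((2 : ℝ) ^ γ) ^ (j + 1) := by
        refine Finset.sum_le_sum fun j _ => ?_
        rw [nsmul_eq_mul]
        gcongr
        refine le_trans ?_ (hcard j N)
        gcongr with n
        rintro rfl
        exact (hk n).2
    _ = C * 2 ^ γ * N * ∑ j ∈ (Finset.range N).image k, (2 ^ γ * t) ^ j := by
        rw [Finset.mul_sum]
        refine Finset.sum_congr rfl fun j _ => ?_
        ring
    _ ≤ C * 2 ^ γ * N * (1 - 2 ^ γ * t)⁻¹ := by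
        rw [← tsum_geometric_of_lt_one hθ hγt]
        gcongr
        exact (summable_geometric_of_lt_one hθ hγt).sum_le_tsum _ fun j _ => by positivity
    _ = C * 2 ^ γ * (1 - 2 ^ γ * t)⁻¹ * N := by ring

theorem IsLacunary.ae_exists_sum_norm_sub_rpow_neg_le {q : ℝ} {a : ℕ → ℝ} (ha : IsLacunary q a)
    (z : ℝ) {γ : ℝ} (hγ₀ : 0 ≤ γ) (hγ : γ < 1 / 2) :
    ∀ᵐ x : ℝ, (∀ n, 0 < ‖((a n * x - z : ℝ) : UnitAddCircle)‖) ∧ ∃ C, ∀ N : ℕ,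
      ∑ n ∈ Finset.range N, ‖((a n * x - z : ℝ) : UnitAddCircle)‖ ^ (-γ) ≤ C * N := by
  obtain ⟨t, ht, hγt⟩ := exists_between
    (Real.rpow_lt_rpow_of_exponent_lt one_lt_two (neg_lt_neg hγ))
  have ht₀ : 0 < t := (Real.rpow_pos_of_pos two_pos _).trans ht
  have ht₁ : t < 1 := hγt.trans_le (Real.rpow_le_one_of_one_le_of_nonpos one_le_two (by linarith))
  have htsq : 1 / 2 < t ^ 2 := by
    have h := pow_lt_pow_left₀ ht (by positivity) two_ne_zero
    rwa [← Real.rpow_mul_natCast two_pos.le, show -(1 / 2 : ℝ) * (2 : ℕ) = -1 by norm_num,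
      Real.rpow_neg_one, ← one_div] at h
  have hγt' : 2 ^ γ * t < 1 := by
    rw [Real.rpow_neg two_pos.le] at hγt
    rwa [← lt_inv_mul_iff₀ (by positivity), mul_one]
  filter_upwards [ha.ae_exists_card_norm_sub_le z ht₀ htsq] with x ⟨C, hC, hcard⟩
  have hpos := pos_of_card_le (fun n => norm_nonneg _) ht₀.le ht₁ hcard
  refine ⟨hpos, _, sum_rpow_neg_le_of_card_le hpos (fun n => ?_) hC ht₀.le hγ₀ hγt' hcard⟩
  rw [UnitAddCircle.norm_eq]
  exact (abs_sub_round _).trans (by norm_num)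

/-! ### Riemann-integrable functions along equidistributed sequences -/

/-- The `i`-th of the `n` cells of the uniform subdivision of `[0, 1]`. -/
def gridCell (n : ℕ) (i : Fin n) : Set ℝ := Icc ((i : ℝ) / n) ((i + 1) / n)

/-- The cells of the uniform subdivision of `[0, 1]` as one-dimensional half-open boxes; the
embedding form is what the index map of a `BoxIntegral.Prepartition` needs. -/
noncomputable def gridBox (n : ℕ) [NeZero n] : Fin n ↪ BoxIntegral.Box (Fin 1) where
  toFun i := BoxIntegral.unitPartition.box n fun _ => (i : ℤ)
  inj' := (BoxIntegral.unitPartition.box_injective n).comp fun i j h => by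
    simpa only [Nat.cast_inj, Fin.val_inj] using congrFun h 0

section UniformPartition

variable {n : ℕ} [NeZero n]

theorem mem_Icc_gridBox {i : Fin n} {x : Fin 1 → ℝ} :
    x ∈ BoxIntegral.Box.Icc (gridBox n i) ↔ x 0 ∈ gridCell n i := by
  simp [gridBox, gridCell, BoxIntegral.Box.Icc_def, Pi.le_def]

theorem gridBox_le (i : Fin n) : gridBox n i ≤ intervalBox 0 1 zero_lt_one := by
  have hn : (0 : ℝ) < n := Nat.cast_pos.2 (NeZero.pos n)
  have hi : ((i : ℤ) : ℝ) + 1 ≤ n := by exact_mod_cast i.2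
  refine BoxIntegral.Box.le_iff_bounds.2 ⟨fun _ => ?_, fun _ => (div_le_one hn).2 hi⟩
  exact div_nonneg (by simp) hn.le

/-- The partition of `[0, 1]` into the boxes `gridBox n i`, with tags `t i`. Mathlib's
`BoxIntegral.unitPartition.prepartition` has fixed tags. -/
noncomputable def uniformPartition (t : Fin n → ℝ) (ht : ∀ i, t i ∈ gridCell n i) :
    BoxIntegral.TaggedPrepartition (intervalBox 0 1 zero_lt_one) where
  boxes := Finset.univ.map (gridBox n)
  le_of_mem' J hJ := by
    obtain ⟨i, -, rfl⟩ := Finset.mem_map.1 hJ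
    exact gridBox_le i
  pairwiseDisjoint := by
    intro J hJ J' hJ' hne
    obtain ⟨i, -, rfl⟩ := Finset.mem_map.1 hJ
    obtain ⟨j, -, rfl⟩ := Finset.mem_map.1 hJ'
    exact BoxIntegral.unitPartition.disjoint.1
      (ne_of_apply_ne (BoxIntegral.unitPartition.box n) hne)
  tag := Function.extend (gridBox n) (fun i _ => t i) 0
  tag_mem_Icc J := by
    by_cases h : ∃ i, gridBox n i = J
    · obtain ⟨i, rfl⟩ := h
      rw [(gridBox n).injective.extend_apply]
      exact BoxIntegral.Box.le_iff_Icc.1 (gridBox_le i) (mem_Icc_gridBox.2 (ht i))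
    · rw [Function.extend_apply' _ _ _ h]
      simp [BoxIntegral.Box.Icc_def, intervalBox, Pi.le_def]

variable {t : Fin n → ℝ} {ht : ∀ i, t i ∈ gridCell n i}

theorem mem_uniformPartition {J : BoxIntegral.Box (Fin 1)} :
    J ∈ uniformPartition t ht ↔ ∃ i, gridBox n i = J := by
  rw [← BoxIntegral.TaggedPrepartition.mem_toPrepartition, ← BoxIntegral.Prepartition.mem_boxes]
  simp [uniformPartition]

theorem uniformPartition_tag (i : Fin n) :
    (uniformPartition t ht).tag (gridBox n i) = fun _ => t i := by
  simp only [uniformPartition, (gridBox n).injective.extend_apply]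

theorem isPartition_uniformPartition : (uniformPartition t ht).IsPartition := by
  intro x hx
  have hn : (0 : ℝ) < n := Nat.cast_pos.2 (NeZero.pos n)
  obtain ⟨hx₀, hx₁⟩ : 0 < x 0 ∧ x 0 ≤ 1 := hx 0
  have hceil : 0 < ⌈n * x 0⌉ := Int.ceil_pos.2 (by positivity)
  have hceil' : ⌈n * x 0⌉ ≤ n := Int.ceil_le.2 (by
    rw [Int.cast_natCast]
    exact mul_le_of_le_one_right hn.le hx₁)
  refine ⟨gridBox n ⟨(⌈n * x 0⌉ - 1).toNat, by lia⟩, mem_uniformPartition.2 ⟨_, rfl⟩, ?_⟩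
  refine BoxIntegral.unitPartition.mem_box_iff_index.2 (funext fun j => ?_)
  rw [Fin.fin_one_eq_zero j, BoxIntegral.unitPartition.index_apply]
  exact (Int.toNat_of_nonneg (by lia)).symm

theorem integralSum_uniformPartition (g : ℝ → ℂ) :
    BoxIntegral.integralSum (fun x : Fin 1 → ℝ => g (x 0))
      ((volume : Measure (Fin 1 → ℝ)).toBoxAdditive.toSMul (E := ℂ)) (uniformPartition t ht)
      = (n : ℝ)⁻¹ • ∑ i, g (t i) := by
  rw [Finset.smul_sum]
  refine (Finset.sum_map _ _ _).trans (Finset.sum_congr rfl fun i _ => ?_)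
  rw [uniformPartition_tag, BoxIntegral.BoxAdditiveMap.toSMul_apply, Measure.toBoxAdditive_apply,
    measureReal_def, gridBox, Function.Embedding.coeFn_mk, BoxIntegral.unitPartition.volume_box]
  simp

theorem memBaseSet_uniformPartition {c : NNReal} {r : (Fin 1 → ℝ) → Ioi (0 : ℝ)}
    (hr : ∀ x, 1 / (n : ℝ) ≤ r x) :
    BoxIntegral.IntegrationParams.Riemann.MemBaseSet (intervalBox 0 1 zero_lt_one) c r
      (uniformPartition t ht) where
  isSubordinate J hJ x hx := by
    obtain ⟨i, rfl⟩ := mem_uniformPartition.1 hJ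
    have htag : (uniformPartition t ht).tag (gridBox n i) ∈ BoxIntegral.Box.Icc (gridBox n i) := by
      rw [uniformPartition_tag]
      exact mem_Icc_gridBox.2 (ht i)
    exact ((Metric.dist_le_diam_of_mem (BoxIntegral.Box.isBounded_Icc _) hx htag).trans
      (BoxIntegral.unitPartition.diam_boxIcc n _)).trans (hr _)
  isHenstock _ J hJ := by
    obtain ⟨i, rfl⟩ := mem_uniformPartition.1 hJ
    rw [uniformPartition_tag]
    exact mem_Icc_gridBox.2 (ht i)
  distortion_le h := absurd h (by decide)
  exists_compl h := absurd h (by decide)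

end UniformPartition

theorem RiemannIntegrableIcc.hasIntegral {g : ℝ → ℂ} {a b : ℝ} (hg : RiemannIntegrableIcc g a b)
    (hab : a < b) (hgi : IntervalIntegrable g volume a b) :
    BoxIntegral.HasIntegral (intervalBox a b hab) BoxIntegral.IntegrationParams.Riemann
      (fun x : Fin 1 → ℝ => g (x 0))
      ((volume : Measure (Fin 1 → ℝ)).toBoxAdditive.toSMul (E := ℂ)) (∫ y in a..b, g y) := by
  have hmp := volume_preserving_funUnique (Fin 1) ℝ
  have hpre : (intervalBox a b hab : Set (Fin 1 → ℝ))
      = MeasurableEquiv.funUnique (Fin 1) ℝ ⁻¹' Ioc a b := by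
    ext x
    simp [BoxIntegral.Box.mem_def, intervalBox, Fin.forall_fin_one]
  have hint : IntegrableOn (fun x : Fin 1 → ℝ => g (x 0)) (intervalBox a b hab) := by
    rw [hpre]
    exact (hmp.integrableOn_comp_preimage (MeasurableEquiv.measurableEmbedding _)).2
      ((intervalIntegrable_iff_integrableOn_Ioc_of_le hab.le).1 hgi)
  have hintegral : ∫ x in (intervalBox a b hab : Set (Fin 1 → ℝ)), g (x 0)
      = ∫ y in a..b, g y := by
    rw [hpre, intervalIntegral.integral_of_le hab.le]
    exact hmp.setIntegral_preimage_emb (MeasurableEquiv.measurableEmbedding _) g _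
  -- The Riemann and the Lebesgue integrals are both Henstock integrals.
  rw [← hintegral, (hint.hasBoxIntegral .Henstock rfl).unique
    ((hg hab).hasIntegral.mono BoxIntegral.IntegrationParams.henstock_le_riemann)]
  exact (hg hab).hasIntegral

theorem RiemannIntegrableIcc.eventually_norm_sum_sub_integral_le {g : ℝ → ℂ}
    (hg : RiemannIntegrableIcc g 0 1) (hgi : IntervalIntegrable g volume 0 1) {ε : ℝ}
    (hε : 0 < ε) :
    ∀ᶠ n : ℕ in atTop, ∀ t : Fin n → ℝ, (∀ i, t i ∈ gridCell n i) →
      ‖(n : ℝ)⁻¹ • ∑ i, g (t i) - ∫ y in (0 : ℝ)..1, g y‖ ≤ ε := by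
  obtain ⟨r, hr, hsum⟩ := BoxIntegral.hasIntegral_iff.1 (hg.hasIntegral zero_lt_one hgi) ε hε
  have hmesh := (tendsto_one_div_atTop_nhds_zero_nat (𝕜 := ℝ)).eventually_le_const
    (mem_Ioi.1 (r 0 0).2)
  filter_upwards [hmesh, eventually_ne_atTop 0] with n hn hn₀ t ht
  have : NeZero n := ⟨hn₀⟩
  have h := hsum 0 (uniformPartition t ht)
    (memBaseSet_uniformPartition fun x => hn.trans_eq (congrArg _ (hr 0 rfl x).symm))
    isPartition_uniformPartition
  rwa [integralSum_uniformPartition, dist_eq_norm] at h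

theorem norm_sum_sub_le_of_mem_convexHull {E : Type*} [NormedAddCommGroup E] [NormedSpace ℝ E]
    {n : ℕ} {g : ℝ → E} {I : E} {ε : ℝ}
    (hg : ∀ t : Fin n → ℝ, (∀ i, t i ∈ gridCell n i) → ‖(n : ℝ)⁻¹ • ∑ i, g (t i) - I‖ ≤ ε)
    {c : Fin n → E} (hc : ∀ i, c i ∈ convexHull ℝ (g '' gridCell n i)) :
    ‖(n : ℝ)⁻¹ • ∑ i, c i - I‖ ≤ ε := by
  have hlin : IsLinearMap ℝ fun c : Fin n → E => (n : ℝ)⁻¹ • ∑ i, c i :=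
    ⟨fun c c' => by simp only [Pi.add_apply, Finset.sum_add_distrib, smul_add],
      fun r c => by simp only [Pi.smul_apply, ← Finset.smul_sum, smul_comm r]⟩
  have hsub : (univ.pi fun i => g '' gridCell n i)
      ⊆ (fun c : Fin n → E => (n : ℝ)⁻¹ • ∑ i, c i) ⁻¹' Metric.closedBall I ε := by
    intro c hc
    choose t ht htc using fun i => hc i (mem_univ i)
    rw [mem_preimage, ← funext htc, mem_closedBall_iff_norm]
    exact hg t ht
  have hhull := convexHull_min hsub ((convex_closedBall I ε).is_linear_preimage hlin)
  rw [convexHull_pi] at hhull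
  exact mem_closedBall_iff_norm.1 (hhull fun i _ => hc i)

theorem exists_norm_le_of_norm_sum_sub_le {E : Type*} [NormedAddCommGroup E] [NormedSpace ℝ E]
    {n : ℕ} {g : ℝ → E} {I : E} {ε : ℝ}
    (hg : ∀ t : Fin n → ℝ, (∀ i, t i ∈ gridCell n i) → ‖(n : ℝ)⁻¹ • ∑ i, g (t i) - I‖ ≤ ε) :
    ∃ M, ∀ i, ∀ y ∈ gridCell n i, ‖g y‖ ≤ M := by
  have hleft : ∀ j : Fin n, (j : ℝ) / n ∈ gridCell n j := fun j =>
    ⟨le_rfl, by gcongr; linarith⟩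
  refine ⟨∑ j : Fin n, ‖g (j / n)‖ + n * (ε + ε), fun i y hy => ?_⟩
  have hn : (0 : ℝ) < n := Nat.cast_pos.2 i.pos
  have hupdate : ∀ j, Function.update (fun j : Fin n => (j : ℝ) / n) i y j ∈ gridCell n j := by
    intro j
    rcases eq_or_ne j i with rfl | hji
    · rwa [Function.update_self]
    · rw [Function.update_of_ne hji]
      exact hleft j
  have hdiff : ∑ j, g (Function.update (fun j : Fin n => (j : ℝ) / n) i y j)
      - ∑ j : Fin n, g (j / n) = g y - g (i / n) := by
    rw [← Finset.sum_sub_distrib, Finset.sum_eq_single_of_mem i (Finset.mem_univ i),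
      Function.update_self]
    intro j _ hji
    rw [Function.update_of_ne hji, sub_self]
  have hscaled : (n : ℝ)⁻¹ * ‖g y - g (i / n)‖ ≤ ε + ε := by
    rw [← Real.norm_of_nonneg (inv_nonneg.2 hn.le), ← norm_smul, ← hdiff, smul_sub,
      ← sub_sub_sub_cancel_right _ _ I]
    exact (norm_sub_le _ _).trans (add_le_add (hg _ hupdate) (hg _ hleft))
  rw [inv_mul_le_iff₀ hn] at hscaled
  have hsingle := Finset.single_le_sum (fun j _ => norm_nonneg (g ((j : Fin n) / n)))
    (Finset.mem_univ i)
  linarith [norm_le_insert' (g y) (g (i / n))]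

theorem exists_mem_convexHull_card_smul_eq_sum {ι E : Type*} [AddCommGroup E] [Module ℝ E]
    {s : Finset ι} {p : ι → E} {A : Set E} (hA : A.Nonempty) (hp : ∀ i ∈ s, p i ∈ A) :
    ∃ c ∈ convexHull ℝ A, (s.card : ℝ) • c = ∑ i ∈ s, p i := by
  rcases s.eq_empty_or_nonempty with rfl | hs
  · exact ⟨hA.some, subset_convexHull ℝ A hA.some_mem, by simp⟩
  · have hcard : (s.card : ℝ) ≠ 0 := Nat.cast_ne_zero.2 hs.card_ne_zero
    refine ⟨s.centerMass (fun _ => 1) p, s.centerMass_mem_convexHull (fun _ _ => zero_le_one)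
      (by simpa using hs) hp, ?_⟩
    simp [Finset.centerMass, hcard]

/-- The index of the cell `[i / n, (i + 1) / n)` that contains the fractional part of `y`. -/
noncomputable def gridIndex (n : ℕ) [NeZero n] (y : ℝ) : Fin n :=
  ⟨⌊n * Int.fract y⌋₊, (Nat.floor_lt (by positivity)).2
    (mul_lt_of_lt_one_right (Nat.cast_pos.2 (NeZero.pos n)) (Int.fract_lt_one y))⟩

theorem mem_arc_iff_gridIndex_eq {n : ℕ} [NeZero n] {i : Fin n} {y : ℝ} :
    y ∈ arc (i / n) (1 / n) ↔ gridIndex n y = i := by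
  have hn : (0 : ℝ) < n := Nat.cast_pos.2 (NeZero.pos n)
  have hi : (i : ℝ) + 1 ≤ n := by exact_mod_cast i.2
  rw [mem_arc_iff_fract_mem_Ico (by positivity) (by positivity)
    (by rwa [← add_div, div_le_one hn]), ← add_div, mem_Ico, div_le_iff₀' hn, lt_div_iff₀' hn,
    Fin.ext_iff, gridIndex, Nat.floor_eq_iff (by positivity)]

theorem fract_mem_gridCell_gridIndex (n : ℕ) [NeZero n] (y : ℝ) :
    Int.fract y ∈ gridCell n (gridIndex n y) := by
  have hn : (0 : ℝ) < n := Nat.cast_pos.2 (NeZero.pos n)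
  have hpos : 0 ≤ n * Int.fract y := by positivity
  exact ⟨(div_le_iff₀' hn).2 (Nat.floor_le hpos), (le_div_iff₀' hn).2 (Nat.lt_floor_add_one _).le⟩

theorem norm_average_sub_le_of_norm_sum_sub_le {E : Type*} [NormedAddCommGroup E] [NormedSpace ℝ E]
    {n : ℕ} [NeZero n] {g : ℝ → E} {I : E} {ε M : ℝ}
    (hg : ∀ t : Fin n → ℝ, (∀ i, t i ∈ gridCell n i) → ‖(n : ℝ)⁻¹ • ∑ i, g (t i) - I‖ ≤ ε)
    (hM : ∀ i, ∀ y ∈ gridCell n i, ‖g y‖ ≤ M) (w : ℕ → ℝ) (N : ℕ) :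
    ‖(N : ℝ)⁻¹ • ∑ m ∈ Finset.range N, g (Int.fract (w m)) - I‖
      ≤ M * ∑ i : Fin n, |visits (arc (i / n) (1 / n)) w N / N - 1 / n| + ε := by
  classical
  choose c hc hcsum using fun i : Fin n => exists_mem_convexHull_card_smul_eq_sum
    (s := (Finset.range N).filter fun m => gridIndex n (w m) = i)
    (p := fun m => g (Int.fract (w m))) (A := g '' gridCell n i)
    (Nonempty.image g ⟨i / n, le_rfl, by gcongr; linarith⟩) (by
      intro m hm
      rw [← (Finset.mem_filter.1 hm).2]
      exact mem_image_of_mem g (fract_mem_gridCell_gridIndex n (w m)))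
  have hcM : ∀ i, ‖c i‖ ≤ M := fun i => by
    have hsub : g '' gridCell n i ⊆ Metric.closedBall 0 M := by
      rintro _ ⟨y, hy, rfl⟩
      exact mem_closedBall_zero_iff.2 (hM i y hy)
    exact mem_closedBall_zero_iff.1 (convexHull_min hsub (convex_closedBall 0 M) (hc i))
  have haverage : (N : ℝ)⁻¹ • ∑ m ∈ Finset.range N, g (Int.fract (w m))
      = ∑ i : Fin n, (visits (arc (i / n) (1 / n)) w N / N) • c i := by
    rw [← Finset.sum_fiberwise (Finset.range N) fun m => gridIndex n (w m), Finset.smul_sum]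
    refine Finset.sum_congr rfl fun i _ => ?_
    simp only [← hcsum i, visits_eq_card, mem_arc_iff_gridIndex_eq, smul_smul, inv_mul_eq_div]
  calc ‖(N : ℝ)⁻¹ • ∑ m ∈ Finset.range N, g (Int.fract (w m)) - I‖
      = ‖∑ i : Fin n, (visits (arc (i / n) (1 / n)) w N / N - 1 / n) • c i
          + ((n : ℝ)⁻¹ • ∑ i, c i - I)‖ := by
        rw [haverage, Finset.smul_sum, ← add_sub_assoc, ← Finset.sum_add_distrib]
        simp only [sub_smul, one_div, sub_add_cancel]
    _ ≤ ∑ i : Fin n, |visits (arc (i / n) (1 / n)) w N / N - 1 / n| * M + ε := by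
        refine (norm_add_le _ _).trans (add_le_add ?_ (norm_sum_sub_le_of_mem_convexHull hg hc))
        refine norm_sum_le_of_le _ fun i _ => ?_
        rw [norm_smul, Real.norm_eq_abs]
        gcongr
        exact hcM i
    _ = _ := by rw [← Finset.sum_mul, mul_comm]

theorem RiemannIntegrableIcc.tendsto_average {g : ℝ → ℂ} (hg : RiemannIntegrableIcc g 0 1)
    (hgi : IntervalIntegrable g volume 0 1) {w : ℕ → ℝ} (hw : IsEquidistributed w) :
    Tendsto (fun N : ℕ => (N : ℝ)⁻¹ • ∑ m ∈ Finset.range N, g (Int.fract (w m))) atTop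
      (𝓝 (∫ y in (0 : ℝ)..1, g y)) := by
  refine Metric.tendsto_nhds.2 fun ε hε => ?_
  obtain ⟨n, hn, hn₀⟩ := ((hg.eventually_norm_sum_sub_integral_le hgi (half_pos hε)).and
    (eventually_ne_atTop 0)).exists
  have : NeZero n := ⟨hn₀⟩
  obtain ⟨M, hM⟩ := exists_norm_le_of_norm_sum_sub_le hn
  have hdev : Tendsto (fun N : ℕ =>
      M * ∑ i : Fin n, |visits (arc (i / n) (1 / n)) w N / N - 1 / n|) atTop (𝓝 0) := by
    have h := (tendsto_finsetSum Finset.univ fun i _ =>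
      ((hw n i).sub_const (1 / (n : ℝ))).abs).const_mul M
    simpa only [sub_self, abs_zero, Finset.sum_const_zero, mul_zero] using h
  filter_upwards [hdev.eventually_lt_const (half_pos hε)] with N hN
  rw [dist_eq_norm]
  linarith [norm_average_sub_le_of_norm_sum_sub_le hn hM w N]

/-! ### Singularities -/

/-- Points of the sequence `w` modulo `1` that are close to `F` contribute little to the averages
of `‖f‖` along `w`, uniformly in the length of the average. -/
def IsNegligibleNear {E : Type*} [NormedAddCommGroup E] (f : ℝ → E) (F : Set ℝ) (w : ℕ → ℝ) :
    Prop :=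
  ∀ ε > 0, ∀ᶠ ρ in 𝓝[>] (0 : ℝ), ∀ N : ℕ,
    ∑ n ∈ Finset.range N, (Metric.thickening ρ F).indicator (fun y => ‖f y‖) (Int.fract (w n))
      ≤ ε * N

section NegligibleNear

variable {E : Type*} [NormedAddCommGroup E] {f : ℝ → E} {F G : Set ℝ} {w : ℕ → ℝ}

theorem IsNegligibleNear.union (hF : IsNegligibleNear f F w) (hG : IsNegligibleNear f G w) :
    IsNegligibleNear f (F ∪ G) w := by
  intro ε hε
  filter_upwards [hF _ (half_pos hε), hG _ (half_pos hε)] with ρ hFρ hGρ N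
  have hunion : ∀ y, (Metric.thickening ρ (F ∪ G)).indicator (fun y => ‖f y‖) y
      ≤ (Metric.thickening ρ F).indicator (fun y => ‖f y‖) y
        + (Metric.thickening ρ G).indicator (fun y => ‖f y‖) y := by
    intro y
    rw [Metric.thickening_union, ← Pi.add_apply (Set.indicator _ _), ← indicator_union_add_inter]
    exact le_add_of_nonneg_right (indicator_nonneg (fun _ _ => norm_nonneg _) _)
  refine (Finset.sum_le_sum fun n _ => hunion (Int.fract (w n))).trans ?_
  rw [Finset.sum_add_distrib]
  linarith [hFρ N, hGρ N]

theorem isNegligibleNear_of_finite (hF : F.Finite) (h : ∀ z ∈ F, IsNegligibleNear f {z} w) :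
    IsNegligibleNear f F w := by
  induction F, hF using Set.Finite.induction_on with
  | empty =>
    refine fun ε hε => .of_forall fun ρ N => ?_
    simp only [Metric.thickening_empty, indicator_empty, Finset.sum_const_zero]
    positivity
  | insert _ _ ih =>
    rw [insert_eq]
    exact (h _ (mem_insert _ _)).union (ih fun z hz => h z (mem_insert_of_mem _ hz))

theorem isLittleO_abs_sub_rpow_neg (z : ℝ) {β γ : ℝ} (hβγ : β < γ) :
    (fun y : ℝ => |y - z| ^ (-β)) =o[𝓝[≠] z] fun y => |y - z| ^ (-γ) := by
  have hpos : ∀ᶠ y in 𝓝[≠] z, 0 < |y - z| := by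
    filter_upwards [self_mem_nhdsWithin] with y hy using abs_pos.2 (sub_ne_zero.2 hy)
  refine Asymptotics.isLittleO_of_tendsto' ?_ ?_
  · filter_upwards [hpos] with y hy h
    exact absurd h (Real.rpow_pos_of_pos hy _).ne'
  · have hlim : Tendsto (fun y : ℝ => |y - z| ^ (γ - β)) (𝓝[≠] z) (𝓝 0) := by
      have h : ContinuousAt (fun y : ℝ => |y - z| ^ (γ - β)) z :=
        ContinuousAt.rpow_const (by fun_prop) (.inr (sub_pos.2 hβγ).le)
      simpa [(sub_pos.2 hβγ).ne'] using h.tendsto.mono_left nhdsWithin_le_nhds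
    refine hlim.congr' ?_
    filter_upwards [hpos] with y hy
    rw [← Real.rpow_sub hy]
    congr 1
    ring

theorem isNegligibleNear_singleton_of_sum_rpow_neg_le {z β γ C : ℝ}
    (hf : f =O[𝓝[≠] z] fun y => |y - z| ^ (-β)) (hβγ : β < γ) (hγ : 0 ≤ γ)
    (hw : ∀ n, 0 < ‖((w n - z : ℝ) : UnitAddCircle)‖)
    (hsum : ∀ N : ℕ,
      ∑ n ∈ Finset.range N, ‖((w n - z : ℝ) : UnitAddCircle)‖ ^ (-γ) ≤ C * N) :
    IsNegligibleNear f {z} w := by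
  intro ε hε
  have hlittle := (hf.trans_isLittleO (isLittleO_abs_sub_rpow_neg z hβγ)).bound
    (c := ε / (|C| + 1)) (by positivity)
  obtain ⟨ρ₀, hρ₀, hbound⟩ := Metric.mem_nhdsWithin_iff.1 hlittle
  filter_upwards [Ioo_mem_nhdsGT hρ₀] with ρ hρ N
  have hterm : ∀ n, (Metric.thickening ρ {z}).indicator (fun y => ‖f y‖) (Int.fract (w n))
      ≤ ε / (|C| + 1) * ‖((w n - z : ℝ) : UnitAddCircle)‖ ^ (-γ) := by
    intro n
    have hdist := norm_sub_le_abs_fract_sub (w n) z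
    refine indicator_apply_le' (fun hmem => ?_) fun _ => by positivity
    rw [Metric.thickening_singleton] at hmem
    have hne : Int.fract (w n) ≠ z := sub_ne_zero.1 (abs_pos.1 ((hw n).trans_le hdist))
    have h := hbound ⟨Metric.ball_subset_ball hρ.2.le hmem, hne⟩
    rw [mem_ofPred_eq, Real.norm_of_nonneg (by positivity)] at h
    refine h.trans (mul_le_mul_of_nonneg_left ?_ (by positivity))
    exact Real.rpow_le_rpow_of_nonpos (hw n) hdist (neg_nonpos.2 hγ)
  calc _ ≤ ∑ n ∈ Finset.range N,
          ε / (|C| + 1) * ‖((w n - z : ℝ) : UnitAddCircle)‖ ^ (-γ) :=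
        Finset.sum_le_sum fun n _ => hterm n
    _ ≤ ε / (|C| + 1) * ((|C| + 1) * N) := by
        rw [← Finset.mul_sum]
        gcongr
        exact (hsum N).trans (by gcongr; linarith [le_abs_self C])
    _ = ε * N := by field_simp

theorem IsLacunary.ae_isNegligibleNear {q : ℝ} {a : ℕ → ℝ} (ha : IsLacunary q a)
    (hF : F.Finite) (hf : ∀ z ∈ F, ∃ β : ℝ, β < 1 / 2 ∧
      f =O[𝓝[≠] z] fun y => |y - z| ^ (-β)) :
    ∀ᵐ x : ℝ, IsNegligibleNear f F fun n => a n * x := by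
  have hsingleton : ∀ᵐ x : ℝ, ∀ z ∈ F, IsNegligibleNear f {z} fun n => a n * x := by
    refine (ae_ball_iff hF.countable).2 fun z hz => ?_
    obtain ⟨β, hβ, hfz⟩ := hf z hz
    obtain ⟨γ, hγ, hγ'⟩ := exists_between (max_lt hβ one_half_pos)
    obtain ⟨hβγ, hγ₀⟩ := max_lt_iff.1 hγ
    filter_upwards [ha.ae_exists_sum_norm_sub_rpow_neg_le z hγ₀.le hγ'] with x ⟨hx, C, hC⟩
    exact isNegligibleNear_singleton_of_sum_rpow_neg_le hfz hβγ hγ₀.le hx hC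
  filter_upwards [hsingleton] with x hx using isNegligibleNear_of_finite hF hx

end NegligibleNear

theorem tendsto_intervalIntegral_indicator_thickening {E : Type*} [NormedAddCommGroup E]
    [NormedSpace ℝ E] {f : ℝ → E} {F : Set ℝ} {a b : ℝ} (hf : IntervalIntegrable f volume a b)
    (hab : a ≤ b) (hF : IsClosed F) (hF₀ : volume F = 0) :
    Tendsto (fun ρ => ∫ y in a..b, (Metric.thickening ρ F).indicator f y) (𝓝[>] 0) (𝓝 0) := by
  have hmeasure : Tendsto (fun ρ => volume.restrict (Ioc a b) (Metric.thickening ρ F)) (𝓝[>] 0)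
      (𝓝 0) := by
    rw [← Measure.restrict_apply_eq_zero' measurableSet_Ioc |>.2
      (measure_mono_null inter_subset_left hF₀)]
    exact tendsto_measure_thickening_of_isClosed ⟨1, one_pos, measure_ne_top _ _⟩ hF
  refine (((intervalIntegrable_iff_integrableOn_Ioc_of_le hab).1
    hf).tendsto_setIntegral_nhds_zero hmeasure).congr fun ρ => ?_
  rw [intervalIntegral.integral_of_le hab,
    integral_indicator Metric.isOpen_thickening.measurableSet]

theorem indicator_diff_add_indicator_apply {α M : Type*} [AddZeroClass M] {f : α → M}
    {A U : Set α} {y : α} (hy : y ∈ A) :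
    (A \ U).indicator f y + U.indicator f y = f y := by
  by_cases hyU : y ∈ U <;> simp [hy, hyU]

theorem sum_eq_sum_indicator_diff_add_sum_indicator {M : Type*} [AddCommMonoid M] {f : ℝ → M}
    (hf : Function.Periodic f 1) (U : Set ℝ) (w : ℕ → ℝ) (N : ℕ) :
    ∑ n ∈ Finset.range N, f (w n)
      = ∑ n ∈ Finset.range N, (Icc 0 1 \ U).indicator f (Int.fract (w n))
        + ∑ n ∈ Finset.range N, U.indicator f (Int.fract (w n)) := by
  rw [← Finset.sum_add_distrib]
  refine Finset.sum_congr rfl fun n _ => ?_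
  have hfract : Int.fract (w n) ∈ Icc (0 : ℝ) 1 := ⟨Int.fract_nonneg _, (Int.fract_lt_one _).le⟩
  rw [indicator_diff_add_indicator_apply hfract, ← Int.self_sub_floor, ← mul_one (⌊w n⌋ : ℝ),
    hf.sub_int_mul_eq]

theorem norm_average_indicator_le {E : Type*} [NormedAddCommGroup E] [NormedSpace ℝ E]
    {f : ℝ → E} {U : Set ℝ} {v : ℕ → ℝ} {N : ℕ} {ε : ℝ} (hε : 0 ≤ ε)
    (h : ∑ n ∈ Finset.range N, U.indicator (fun y => ‖f y‖) (v n) ≤ ε * N) :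
    ‖(N : ℝ)⁻¹ • ∑ n ∈ Finset.range N, U.indicator f (v n)‖ ≤ ε := by
  rw [norm_smul, norm_inv, Real.norm_natCast]
  refine inv_mul_le_of_le_mul₀ N.cast_nonneg hε ((norm_sum_le _ _).trans ?_)
  simpa only [norm_indicator_eq_indicator_norm, mul_comm (N : ℝ)] using h

theorem tendsto_average_of_isNegligibleNear {f : ℝ → ℂ} {F : Set ℝ} {w : ℕ → ℝ}
    (hf : Function.Periodic f 1) (hfi : IntervalIntegrable f volume 0 1) (hF : IsClosed F)
    (hF₀ : volume F = 0)
    (hriem : ∀ δ : ℝ, 0 < δ → RiemannIntegrableOn f (Icc 0 1 \ (F + Ioo (-δ) δ)) 0 1)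
    (hw : IsEquidistributed w) (hnear : IsNegligibleNear f F w) :
    Tendsto (fun N : ℕ => (N : ℝ)⁻¹ • ∑ n ∈ Finset.range N, f (w n)) atTop
      (𝓝 (∫ y in (0 : ℝ)..1, f y)) := by
  refine Metric.tendsto_nhds.2 fun ε hε => ?_
  have hε₃ : 0 < ε / 3 := by positivity
  have hintegral := (tendsto_intervalIntegral_indicator_thickening hfi zero_le_one hF
    hF₀).norm.eventually_lt_const (by rwa [norm_zero])
  obtain ⟨ρ, ⟨hρnear, hρint⟩, hρ⟩ :=
    (((hnear _ hε₃).and hintegral).and self_mem_nhdsWithin).exists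
  have hadd : F + Ioo (-ρ) ρ = Metric.thickening ρ F := by
    rw [← add_ball_zero, Real.ball_eq_Ioo, zero_sub, zero_add]
  have hg := hriem ρ hρ
  rw [hadd] at hg
  set U := Metric.thickening ρ F
  have hU : MeasurableSet U := Metric.isOpen_thickening.measurableSet
  have hindicator : ∀ {A : Set ℝ}, MeasurableSet A →
      IntervalIntegrable (A.indicator f) volume 0 1 := fun hA =>
    ⟨hfi.1.indicator hA, hfi.2.indicator hA⟩
  have hgi := hindicator (measurableSet_Icc (a := (0 : ℝ)) (b := 1) |>.diff hU)
  have hsplit : ∫ y in (0 : ℝ)..1, f y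
      = (∫ y in (0 : ℝ)..1, (Icc 0 1 \ U).indicator f y)
        + ∫ y in (0 : ℝ)..1, U.indicator f y := by
    rw [← intervalIntegral.integral_add hgi (hindicator hU)]
    refine intervalIntegral.integral_congr fun y hy => ?_
    rw [uIcc_of_le zero_le_one] at hy
    exact (indicator_diff_add_indicator_apply hy).symm
  filter_upwards [(Metric.tendsto_nhds.1 (RiemannIntegrableIcc.tendsto_average hg hgi hw)) _ hε₃]
    with N hN
  rw [dist_eq_norm] at hN ⊢
  rw [sum_eq_sum_indicator_diff_add_sum_indicator hf U, hsplit, smul_add, add_sub_add_comm]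
  refine (norm_add_le _ _).trans_lt ?_
  linarith [norm_sub_le ((N : ℝ)⁻¹ • ∑ n ∈ Finset.range N, U.indicator f (Int.fract (w n)))
    (∫ y in (0 : ℝ)..1, U.indicator f y), norm_average_indicator_le hε₃.le (hρnear N)]

/-! ### Growth at a singularity from the variation -/

theorem norm_sub_le_toReal_lintegral_deriv {E : Type*} [NormedAddCommGroup E]
    [NormedSpace ℝ E] [CompleteSpace E] {f : ℝ → E} {c d : ℝ}
    (hf : ∀ t ∈ Ioo c d, DifferentiableAt ℝ f t)
    (hfin : ∫⁻ t in Ioo c d, ‖deriv f t‖ₑ ≠ ∞) {x y : ℝ} (hx : x ∈ Ioo c d) (hy : y ∈ Ioo c d) :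
    ‖f y - f x‖ ≤ (∫⁻ t in Ioo c d, ‖deriv f t‖ₑ).toReal := by
  have hsub : uIcc x y ⊆ Ioo c d := ordConnected_Ioo.uIcc_subset hx hy
  have hmeas : ∀ μ : Measure ℝ, AEStronglyMeasurable (deriv f) μ := 
    aestronglyMeasurable_deriv f
  have hint : IntervalIntegrable (deriv f) volume x y :=
    (IntegrableOn.mono_set ⟨hmeas _, hfin.lt_top⟩ hsub).intervalIntegrable
  rw [← intervalIntegral.integral_deriv_eq_sub (fun t ht => hf t (hsub ht)) hint]
  refine intervalIntegral.norm_integral_le_integral_norm_uIoc.trans ?_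
  rw [integral_norm_eq_lintegral_enorm (hmeas _)]
  exact ENNReal.toReal_mono hfin (lintegral_mono_set (uIoc_subset_uIcc.trans hsub))

theorem norm_le_add_toReal_V {f : ℝ → ℂ} {z δ s y : ℝ} {N : ℕ}
    (hf : DifferentiableOn ℝ f (Ioo (z - δ) (z + δ) \ {z})) (hV : V f z δ s N ≠ ∞)
    (hNy : 1 / (N : ℝ) ^ s < |y - z|) (hyδ : |y - z| < δ / 2) :
    ‖f y‖ ≤ ‖f (z - δ / 2)‖ + ‖f (z + δ / 2)‖ + (V f z δ s N).toReal := by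
  have hdiff : ∀ t ∈ Ioo (z - δ) (z + δ), t ≠ z → DifferentiableAt ℝ f t := fun t ht htz =>
    hf.differentiableAt ((isOpen_Ioo.sdiff isClosed_singleton).mem_nhds ⟨ht, htz⟩)
  have hN : 0 ≤ 1 / (N : ℝ) ^ s := by positivity
  have hfrom : ∀ c d w, w ∈ Ioo c d → y ∈ Ioo c d → Ioo c d ⊆ Ioo (z - δ) (z + δ) \ {z} →
      ∫⁻ t in Ioo c d, ‖deriv f t‖ₑ ≤ V f z δ s N →
      ‖f y‖ ≤ ‖f w‖ + (V f z δ s N).toReal := by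
    intro c d w hw hy hsub hle
    have hvar := norm_sub_le_toReal_lintegral_deriv
      (fun t ht => hdiff t (hsub ht).1 (hsub ht).2) (ne_top_of_le_ne_top hV hle) hw hy
    linarith [norm_le_norm_add_norm_sub (f w) (f y), norm_sub_rev (f w) (f y),
      ENNReal.toReal_mono hV hle]
  rcases le_total z y with hzy | hzy
  · rw [abs_of_nonneg (sub_nonneg.2 hzy)] at hNy hyδ
    have h := hfrom (z + 1 / (N : ℝ) ^ s) (z + δ) (z + δ / 2) ⟨by linarith, by linarith⟩
      ⟨by linarith, by linarith⟩
      (fun t ht => ⟨⟨by linarith [ht.1], ht.2⟩, (by linarith [ht.1] : z < t).ne'⟩)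
      le_add_self
    linarith [norm_nonneg (f (z - δ / 2))]
  · rw [abs_of_nonpos (sub_nonpos.2 hzy)] at hNy hyδ
    have h := hfrom (z - δ) (z - 1 / (N : ℝ) ^ s) (z - δ / 2) ⟨by linarith, by linarith⟩
      ⟨by linarith, by linarith⟩
      (fun t ht => ⟨⟨ht.1, by linarith [ht.2]⟩, (by linarith [ht.2] : t < z).ne⟩)
      le_self_add
    linarith [norm_nonneg (f (z + δ / 2))]

theorem tendsto_natFloor_one_div_abs_sub_add_one (z : ℝ) :
    Tendsto (fun y : ℝ => ⌊1 / |y - z|⌋₊ + 1) (𝓝[≠] z) atTop := by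
  have habs : Tendsto (fun y : ℝ => |y - z|) (𝓝[≠] z) (𝓝[>] 0) := by
    refine tendsto_nhdsWithin_iff.2 ⟨?_, ?_⟩
    · have h : ContinuousAt (fun y : ℝ => |y - z|) z := by fun_prop
      simpa using h.tendsto.mono_left nhdsWithin_le_nhds
    · filter_upwards [self_mem_nhdsWithin] with y hy using abs_pos.2 (sub_ne_zero.2 hy)
  simp only [one_div]
  exact (tendsto_add_atTop_nat 1).comp
    (tendsto_nat_floor_atTop.comp (tendsto_inv_nhdsGT_zero.comp habs))

theorem one_div_natFloor_add_one_lt_and_le {r : ℝ} (hr₀ : 0 < r) (hr₁ : r ≤ 1) :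
    1 / (⌊1 / r⌋₊ + 1 : ℝ) < r ∧ (⌊1 / r⌋₊ + 1 : ℝ) ≤ 2 * r⁻¹ := by
  refine ⟨(one_div_lt (by positivity) hr₀).2 (Nat.lt_floor_add_one _), ?_⟩
  have hfloor : (⌊1 / r⌋₊ : ℝ) ≤ r⁻¹ := (Nat.floor_le (by positivity)).trans_eq (one_div r)
  linarith [(one_le_inv₀ hr₀).2 hr₁]

theorem exists_isBigO_rpow_neg_of_isLittleO_V {f : ℝ → ℂ} {z δ η : ℝ} (hδ : 0 < δ)
    (hf : DifferentiableOn ℝ f (Ioo (z - δ) (z + δ) \ {z})) (hη : 0 < η)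
    (hV : ∀ᶠ N : ℕ in atTop, V f z δ 1 N ≠ ∞)
    (hVo : (fun N : ℕ => (V f z δ 1 N).toReal) =o[atTop]
      fun N : ℕ => (N : ℝ) ^ ((1 : ℝ) / 2 - η)) :
    ∃ β : ℝ, β < 1 / 2 ∧ f =O[𝓝[≠] z] fun y => |y - z| ^ (-β) := by
  set β := max (1 / 2 - η) 0
  have hβ₀ : 0 ≤ β := le_max_right _ _
  have hβη : 1 / 2 - η ≤ β := le_max_left _ _
  refine ⟨β, max_lt (by linarith) one_half_pos, ?_⟩
  set A := ‖f (z - δ / 2)‖ + ‖f (z + δ / 2)‖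
  have hVβ : ∀ᶠ N : ℕ in atTop, V f z δ 1 N ≠ ∞ ∧ (V f z δ 1 N).toReal ≤ (N : ℝ) ^ β := by
    filter_upwards [hV, hVo.bound one_pos, eventually_ge_atTop 1] with N hfin hN hN₁
    rw [one_mul, Real.norm_of_nonneg ENNReal.toReal_nonneg,
      Real.norm_of_nonneg (by positivity)] at hN
    exact ⟨hfin, hN.trans (Real.rpow_le_rpow_of_exponent_le (by exact_mod_cast hN₁) hβη)⟩
  have hδ' : 0 < min (δ / 2) 1 := lt_min (half_pos hδ) one_pos
  refine Asymptotics.IsBigO.of_bound (A + 2 ^ β) ?_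
  filter_upwards [(tendsto_natFloor_one_div_abs_sub_add_one z).eventually hVβ,
    self_mem_nhdsWithin, mem_nhdsWithin_of_mem_nhds (Metric.ball_mem_nhds z hδ')]
    with y ⟨hfin, hle⟩ hyz hyδ
  rw [Metric.mem_ball, Real.dist_eq] at hyδ
  obtain ⟨hyδ, hy₁⟩ := lt_min_iff.1 hyδ
  have hy₀ : 0 < |y - z| := abs_pos.2 (sub_ne_zero.2 hyz)
  set N := ⌊1 / |y - z|⌋₊ + 1 with hNdef
  obtain ⟨hNy, hN⟩ : 1 / (N : ℝ) < |y - z| ∧ (N : ℝ) ≤ 2 * |y - z|⁻¹ := by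
    rw [hNdef, Nat.cast_add_one]
    exact one_div_natFloor_add_one_lt_and_le hy₀ hy₁.le
  have hone : 1 ≤ |y - z| ^ (-β) :=
    Real.one_le_rpow_of_pos_of_le_one_of_nonpos hy₀ hy₁.le (neg_nonpos.2 hβ₀)
  rw [Real.norm_of_nonneg (by positivity)]
  calc ‖f y‖ ≤ A + (V f z δ 1 N).toReal := norm_le_add_toReal_V hf hfin (by rwa [Real.rpow_one]) hyδ
    _ ≤ A + (2 * |y - z|⁻¹) ^ β := by gcongr; exact hle.trans (by gcongr)
    _ = A * 1 + 2 ^ β * |y - z| ^ (-β) := by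
        rw [Real.mul_rpow zero_le_two (by positivity), Real.inv_rpow hy₀.le,
          Real.rpow_neg hy₀.le, mul_one]
    _ ≤ A * |y - z| ^ (-β) + 2 ^ β * |y - z| ^ (-β) := by gcongr
    _ = (A + 2 ^ β) * |y - z| ^ (-β) := by ring

end SobolAverage

theorem mainTheorem3_general {q : ℝ} {a : ℕ → ℝ} (ha : SobolAverage.IsLacunary q a) {f : ℝ → ℂ}
    (hf_loc : LocallyIntegrable f volume) (hf_per : Function.Periodic f 1)
    {F : Set ℝ} (hF_fin : F.Finite)
    (hf_riem : ∀ δ : ℝ, 0 < δ →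
      SobolAverage.RiemannIntegrableOn f (Icc 0 1 \ (F + Ioo (-δ) δ)) 0 1)
    (hf_growth : ∀ z ∈ F, ∃ β : ℝ, β < 1 / 2 ∧ f =O[𝓝[≠] z] fun y => |y - z| ^ (-β)) :
    (∀ᵐ x : ℝ ∂volume,
      Tendsto (fun N : ℕ => (1 / (N : ℂ)) * ∑ n ∈ Finset.range N, f (a n * x))
        atTop (𝓝 (∫ y in (0 : ℝ)..1, f y))) ∧
    SobolAverage.HasMean f (∫ y in (0 : ℝ)..1, f y) := by
  have hfi : IntervalIntegrable f volume 0 1 :=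
    (hf_loc.integrableOn_isCompact isCompact_uIcc).intervalIntegrable
  refine ⟨?_, SobolAverage.hasMean_of_periodic hf_per hfi⟩
  filter_upwards [ha.ae_isEquidistributed, ha.ae_isNegligibleNear hF_fin hf_growth]
    with x hequi hnear
  simpa only [Complex.real_smul, Complex.ofReal_inv, Complex.ofReal_natCast, one_div] using
    SobolAverage.tendsto_average_of_isNegligibleNear hf_per hfi hF_fin.isClosed
      (hF_fin.measure_zero volume) hf_riem hequi hnear

theorem mainTheorem3 (α : ℝ) (hα : 1 < |α|) (f : ℝ → ℂ)
    (hf_loc : LocallyIntegrable f volume) (hf_per : Function.Periodic f 1)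
    (F : Set ℝ) (hF_fin : F.Finite) (hF_sub : F ⊆ Icc 0 1)
    (hf_riem : ∀ δ : ℝ, 0 < δ →
      SobolAverage.RiemannIntegrableOn f (Icc 0 1 \ (F + Ioo (-δ) δ)) 0 1)
    (hf_var : ∀ z ∈ F, ∃ δ : ℝ, 0 < δ ∧
      DifferentiableOn ℝ f (Ioo (z - δ) (z + δ) \ {z}) ∧
      ∀ s : ℝ, 0 < s → ∃ η : ℝ, 0 < η ∧
        (∀ᶠ N : ℕ in atTop, SobolAverage.V f z δ s N ≠ ∞) ∧
        (fun N : ℕ => (SobolAverage.V f z δ s N).toReal)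
          =o[atTop] (fun N : ℕ => (N : ℝ) ^ (s / 2 - η))) :
    (∀ᵐ x : ℝ ∂volume,
      Tendsto (fun N : ℕ => (1 / (N : ℂ)) * ∑ n ∈ Finset.range N, f (α ^ n * x))
        atTop (𝓝 (∫ y in (0 : ℝ)..1, f y))) ∧
    SobolAverage.HasMean f (∫ y in (0 : ℝ)..1, f y) :=
  mainTheorem3_general (SobolAverage.isLacunary_pow hα) hf_loc hf_per hF_fin hf_riem fun z hz =>
    let ⟨_, hδ, hdiff, hvar⟩ := hf_var z hz
    let ⟨_, hη, hfin, ho⟩ := hvar 1 one_pos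
    SobolAverage.exists_isBigO_rpow_neg_of_isLittleO_V hδ hdiff hη hfin ho
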